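/- **Setting.** For a field $L$, $\mathrm{GL}_2(L)$ acts on $\mathbb P^1(L)=L\cup\{\infty\}$ by $A*x=\frac{ax+b}{cx+d}$ for $A=\begin{bmatrix}a&b\\c&d\end{bmatrix}$; matrices are considered up to sign. Let $I_0=[0,\infty]\subset\mathbb P^1(\mathbb R)$. Given matrices $A_1,\dots,A_r$ over a real quadratic field $K\subset\mathbb R$, let $I_a=A_a*I_0$, and let the *Gauss map* $T$ be $T(x)=A_a^{-1}*x$ for $x\in I_0$, where $a$ is the smallest index with $x\in I_a$. Let $x\mapsto x'$ be the nontrivial automorphism of $K$ and let $H$ be the absolute multiplicative Weil height on $\mathbb P^1(K)$. Write $\vee$ for maximum. **The nine algorithms.** Put $\lambda_l=2\cos(\pi/l)$, $\tau=(1+\sqrt5)/2$, $$F=\begin{bmatrix}0&1\\1&0\end{bmatrix},\quad J=\begin{bmatrix}-1&0\\0&1\end{bmatrix},\quad Q_l=\begin{bmatrix}\lambda_l&1\\-1&0\end{bmatrix},\quad R_m=\begin{bmatrix}0&1\\-1&\lambda_m\end{bmatrix},\quad P_x=\begin{bmatrix}-1&x\\0&1\end{bmatrix},\quad M_y=\begin{bmatrix}1&0\\y&-1\end{bmatrix}.$$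 * $(l,m,\infty)\in\{(2,5,\infty),(3,4,\infty),(3,5,\infty),(3,6,\infty)\}$, with $K=\mathbb Q(\sqrt5),\mathbb Q(\sqrt2),\mathbb Q(\sqrt5),\mathbb Q(\sqrt3)$ respectively: $r=(l-1)(m-1)$; list the $R_m^iQ_l^j$ ($1\le i<m$, $1\le j<l$) in lexicographic order of $(i,j)$, and multiply those in odd position on the right by $F$. * $(l,\infty,\infty)$, $l=4,5,6$, with $K=\mathbb Q(\sqrt2),\mathbb Q(\sqrt5),\mathbb Q(\sqrt3)$ and $\beta=2+\sqrt2,\ 2+\tau,\ 2+\sqrt3$ respectively: $r=2l-1$, $A_{1+2q}=(M_\beta P_1)^qM_\beta J$ for $0\le q\le l-1$ and $A_{2+2q}=(M_\beta P_1)^{q+1}J$ for $0\le q\le l-2$. * $(4,6,\infty)$, with $K=\mathbb Q(\sqrt6)$, $r=15$, $(\alpha,\beta,\gamma,\delta)=(3-\sqrt6,\,3+\sqrt6,\,2-\sqrt6,\,-2-\sqrt6)$, and $(4,12,\infty)$, with $K=\mathbb Q(\sqrt3)$, $r=33$, $(\alpha,\beta,\gamma,\delta)=(1,\,2+\sqrt3,\,1-\sqrt3,\,-1-\sqrt3)$: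 with $U_1=P_\gamma$, $U_2=P_\gamma M_\delta$, $U_3=P_\gamma M_\delta P_\gamma$, $V_{2q}=(M_\beta P_\alpha)^q$, $V_{2q+1}=(M_\beta P_\alpha)^qM_\beta$, the matrices $A_1,\dots,A_r$ are, in this order, $V_1U_3,V_1U_2,V_1U_1,\ V_2U_1,V_2U_2,V_2U_3,\ V_3U_3,V_3U_2,V_3U_1,\dots,V_{r/3}U_3,V_{r/3}U_2,V_{r/3}U_1$. **Decreasing blocks.** For a matrix $A=\begin{bmatrix}a&b\\c&d\end{bmatrix}$ over $K$ with all entries $\ge0$ (up to a common sign) let $$f_A(x)=\frac{(ax+b)\vee(cx+d)}{x\vee1}\ \ (x\in[0,\infty]),\qquad t(A)=(|a'|+|c'|)\vee(|b'|+|d'|),\qquad E^\sharp(A)=\{x\in[0,\infty]:f_A(x)>t(A)\},$$ where $f_A(\infty)=a\vee c$. A word $b_0b_1\cdots b_u$ over $\{1,\dots,r\}$ with $u\ge1$ is a *decreasing block* if, with $A=A_{b_0}\cdots A_{b_{u-1}}$: (i) $b_0\ne r\ne b_u$; (ii) $I_{b_u}$ is contained in the closure of $E^\sharp(A)$; (iii)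 if $A$ has a zero entry, then $t(A)\bigl(|a'\beta'+b'|\vee|c'\beta'+d'|\bigr)>|\beta'|\vee1$ for each $\beta\in\partial E^\sharp(A)\cap\partial I_{b_u}$ (closures and boundaries in $\mathbb P^1(\mathbb R)$). A set $\mathcal B$ of decreasing blocks is *complete* if $\det A_1=\pm1$ and every infinite word over $\{1,\dots,r\}$ that does not start with $r$, does not end with $rrr\cdots$ and, in case $\det A_1=+1$, does not end with $111\cdots$ either, begins with a block in $\mathcal B$. **Theorem.** For each of the nine algorithms the following hold. 1. All entries of $A_1,\dots,A_r$ are algebraic integers of $K$. 2. There is a complete set $\mathcal B$ of decreasing blocks, with the following property. Let $\mathbf s=s_0s_1s_2\cdots$ be an infinite word over $\{1,\dots,r\}$ that does not end with $rrr\cdots$ nor, if $\det A_1=+1$, with $111\cdots$. Then there are $0\le t_0<t_1<t_2<\cdots$ such that $s_i=r$ for all $i<t_0$, each $s_{t_k}\cdots s_{t_{k+1}}$ is in $\mathcal B$, and for all $N\ge0$ and $\alpha\in\mathbb P^1(K)$ with $T^i(\alpha)\in I_{s_i}$ for $0\le i<N$, and every $k$ with $t_{k+1}<N$: $$H(T^{t_{k+1}}(\alpha))\le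 H(T^{t_k}(\alpha)),$$ with equality if and only if $T^{t_k}(\alpha)=1$; in this exceptional case, $T^{t_{k+1}}(\alpha)=0$ and $t_{k+2}\ge N$. 3. For every $\alpha\in\mathbb P^1(K)\cap[0,\infty]$ there is $n\ge0$ such that $T^n(\alpha)$ is a parabolic fixed point, that is, a fixed point of $T$ that is fixed by a parabolic matrix among $A_1,\dots,A_r$. -/

import Mathlib

open Matrix Filter
open scoped OnePoint

noncomputable section

namespace QuadGauss

/-! ### Real quadratic fields

`QuadField D` is `ℚ(√D)`; the element `⟨x, y⟩` stands for `x + y √D`. -/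

/-- The field `ℚ(√D)`, for `D` not a square. -/
abbrev QuadField (D : ℕ) : Type := QuadraticAlgebra ℚ (D : ℚ) 0

/-- The embedding `x + y √D ↦ x + y √D` of `ℚ(√D)` in `ℝ`. -/
def embed (D : ℕ) : QuadField D →+* ℝ :=
  (QuadraticAlgebra.lift (R := ℚ) (A := ℝ) (a := (D : ℚ)) (b := 0)
    ⟨√(D : ℝ), by simp [Algebra.smul_def]⟩).toRingHom

/-- The conjugate embedding `x + y √D ↦ x - y √D` of `ℚ(√D)` in `ℝ`. -/
def embedConj (D : ℕ) : QuadField D →+* ℝ :=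
  (QuadraticAlgebra.lift (R := ℚ) (A := ℝ) (a := (D : ℚ)) (b := 0)
    ⟨-√(D : ℝ), by simp [Algebra.smul_def]⟩).toRingHom

theorem embed_apply (D : ℕ) (z : QuadField D) : embed D z = z.re + z.im * √(D : ℝ) := by
  simp [embed, QuadraticAlgebra.lift, Algebra.smul_def]

theorem embedConj_apply (D : ℕ) (z : QuadField D) :
    embedConj D z = z.re - z.im * √(D : ℝ) := by
  simp [embedConj, QuadraticAlgebra.lift, Algebra.smul_def, sub_eq_add_neg]

instance instNumberField (D : ℕ) [Fact (∀ q : ℚ, q ^ 2 ≠ (D : ℚ) + 0 * q)] :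
    NumberField (QuadField D) where
  to_charZero := ⟨fun m n h => by
    have h' := congrArg QuadraticAlgebra.re h
    simpa using h'⟩
  to_finiteDimensional := by
    convert (inferInstance : Module.Finite ℚ (QuadraticAlgebra ℚ (D : ℚ) 0))

/-! ### Gauss maps

The projective line over a field `L` is `OnePoint L`, on which `GL (Fin 2) L` acts by Möbius
transformations. A slow continued fraction algorithm is given by its defining matrices
`A 0, …, A n`, where `A a` is the matrix that is usually numbered `a + 1`; so `r = n + 1`, and
`Fin.last n` is the last digit `r`. The matrices are only relevant up to sign.
The field `L` comes with an embedding `σ` in `ℝ`. -/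

section Gauss

variable {L : Type} [Field L] [DecidableEq L]

/-- The base interval `I₀ = [0, ∞]` of the real projective line. -/
def baseInterval : Set (OnePoint ℝ) := {x | x = ∞ ∨ ∃ y : ℝ, 0 ≤ y ∧ x = (y : OnePoint ℝ)}

/-- The interval `A * I₀`. -/
def interval (σ : L →+* ℝ) (A : GL (Fin 2) L) : Set (OnePoint ℝ) :=
  (fun x => A.map σ • x) '' baseInterval

open Classical in
/-- The Gauss map `T` determined by `A 0, …, A n`, as a map on the projective line over `L`:
if `a` is the first index such that `x` is in the interval `I_a = A a * I₀`, then
`T x = (A a)⁻¹ * x`. The value at points outside `⋃ a, I_a` is irrelevant. -/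
def gaussMap {n : ℕ} (σ : L →+* ℝ) (A : Fin (n + 1) → GL (Fin 2) L) (x : OnePoint L) :
    OnePoint L :=
  if h : ∃ a, OnePoint.map σ x ∈ interval σ (A a) then
    (A (Fin.find (fun a => OnePoint.map σ x ∈ interval σ (A a)) h))⁻¹ • x
  else x

/-- `x` is a parabolic fixed point of the Gauss map: it is fixed by the map and by one of the
defining matrices, that matrix being parabolic. -/
def IsParabolicFixedPoint {n : ℕ} (σ : L →+* ℝ) (A : Fin (n + 1) → GL (Fin 2) L)
    (x : OnePoint L) : Prop :=
  gaussMap σ A x = x ∧ ∃ a, (A a).IsParabolic ∧ A a • x = x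

/-- The absolute Weil height on the projective line over a number field. Mathlib's height is
relative to the field, whence the exponent. -/
def height [NumberField L] (x : OnePoint L) : ℝ :=
  (OnePoint.equivProjectivization L x).mulHeight ^ ((Module.finrank ℚ L : ℝ)⁻¹)

/-! ### Decreasing blocks

From here on, `σ'` is the second embedding of a real quadratic field in `ℝ`, so that `σ' x` is the
conjugate `x'` of `x`. -/

/-- The function `f(x) = ((a x + b) ∨ (c x + d)) / (x ∨ 1)` on `[0, ∞]`. The absolute values
take care of the choice of the representative with nonnegative entries of a matrix that is
nonnegative up to sign. -/
def growth (σ : L →+* ℝ) (A : GL (Fin 2) L) (x : OnePoint ℝ) : ℝ :=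
  x.elim (max |σ (A 0 0)| |σ (A 1 0)|)
    (fun y => max |σ (A 0 0) * y + σ (A 0 1)| |σ (A 1 0) * y + σ (A 1 1)| / max y 1)

/-- The threshold `t = (|a'| + |c'|) ∨ (|b'| + |d'|)`. -/
def threshold (σ' : L →+* ℝ) (A : GL (Fin 2) L) : ℝ :=
  max (|σ' (A 0 0)| + |σ' (A 1 0)|) (|σ' (A 0 1)| + |σ' (A 1 1)|)

/-- The set `E♯ = {x ∈ [0, ∞] : f(x) > t}`. -/
def sharpSet (σ σ' : L →+* ℝ) (A : GL (Fin 2) L) : Set (OnePoint ℝ) :=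
  {x | x ∈ baseInterval ∧ threshold σ' A < growth σ A x}

/-- A word `b₀ ⋯ b_u`, with `u ≥ 1`, is a decreasing block if, for the matrix
`P = A_{b₀} ⋯ A_{b_{u-1}}`:
`b₀` and `b_u` differ from the last digit; `I_{b_u}` is contained in the closure of `E♯(P)`; and,
if `P` has a zero entry, then `t(P) (|a'β' + b'| ∨ |c'β' + d'|) > |β'| ∨ 1` for every common
boundary point `β` of `E♯(P)` and `I_{b_u}`. The endpoints of `I_{b_u}` are
in the field, and are finite. -/
def IsDecreasingBlock {n : ℕ} (σ σ' : L →+* ℝ) (A : Fin (n + 1) → GL (Fin 2) L)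
    (w : List (Fin (n + 1))) : Prop :=
  ∃ (b₀ : Fin (n + 1)) (v : List (Fin (n + 1))) (bu : Fin (n + 1)) (P : GL (Fin 2) L),
    w = b₀ :: (v ++ [bu]) ∧ P = ((b₀ :: v).map A).prod ∧
    b₀ ≠ Fin.last n ∧ bu ≠ Fin.last n ∧
    interval σ (A bu) ⊆ closure (sharpSet σ σ' P) ∧
    ((∃ i j, P i j = 0) →
      ∀ β : L, ((σ β : ℝ) : OnePoint ℝ) ∈
          frontier (sharpSet σ σ' P) ∩ frontier (interval σ (A bu)) →
        max |σ' β| 1 < threshold σ' P *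
          max |σ' (P 0 0) * σ' β + σ' (P 0 1)| |σ' (P 1 0) * σ' β + σ' (P 1 1)|)

/-- The subword `s_i s_{i+1} ⋯ s_{i+m-1}` of the infinite word `s`. -/
def subword {n : ℕ} (s : ℕ → Fin (n + 1)) (i m : ℕ) : List (Fin (n + 1)) :=
  (List.range m).map (fun k => s (i + k))

/-- The infinite word `s` ends with `b b b ⋯`. -/
def EndsWith {n : ℕ} (s : ℕ → Fin (n + 1)) (b : Fin (n + 1)) : Prop :=
  ∀ᶠ k in atTop, s k = b

/-- `B` is a complete set of decreasing blocks. The first digit of the alphabet is `0`. -/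
def IsCompleteSet {n : ℕ} (σ σ' : L →+* ℝ) (A : Fin (n + 1) → GL (Fin 2) L)
    (B : Set (List (Fin (n + 1)))) : Prop :=
  (∀ w ∈ B, IsDecreasingBlock σ σ' A w) ∧
  (((A 0).val.det = -1 ∧
      ∀ s : ℕ → Fin (n + 1), s 0 ≠ Fin.last n → ¬ EndsWith s (Fin.last n) →
        ∃ m, subword s 0 m ∈ B) ∨
    ((A 0).val.det = 1 ∧
      ∀ s : ℕ → Fin (n + 1), s 0 ≠ Fin.last n → ¬ EndsWith s (Fin.last n) → ¬ EndsWith s 0 →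
        ∃ m, subword s 0 m ∈ B))

end Gauss

/-! ### The nine algorithms -/

section Matrices

variable {L : Type} [Field L]

/-- `F = [0 1; 1 0]`. -/
def matF : GL (Fin 2) L :=
  GeneralLinearGroup.mkOfDetNeZero !![0, 1; 1, 0] (by simp [det_fin_two])

/-- `J = [-1 0; 0 1]`. -/
def matJ : GL (Fin 2) L :=
  GeneralLinearGroup.mkOfDetNeZero !![-1, 0; 0, 1] (by simp [det_fin_two])

/-- `Q = [lam 1; -1 0]`. -/
def matQ (lam : L) : GL (Fin 2) L :=
  GeneralLinearGroup.mkOfDetNeZero !![lam, 1; -1, 0] (by simp [det_fin_two])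

/-- `R = [0 1; -1 lam]`. -/
def matR (lam : L) : GL (Fin 2) L :=
  GeneralLinearGroup.mkOfDetNeZero !![0, 1; -1, lam] (by simp [det_fin_two])

/-- `P_x = [-1 x; 0 1]`. -/
def matP (x : L) : GL (Fin 2) L :=
  GeneralLinearGroup.mkOfDetNeZero !![-1, x; 0, 1] (by simp [det_fin_two])

/-- `M_y = [1 0; y -1]`. -/
def matM (y : L) : GL (Fin 2) L :=
  GeneralLinearGroup.mkOfDetNeZero !![1, 0; y, -1] (by simp [det_fin_two])

/-- The matrices for `(l, m, ∞)`, with `lamL = 2 cos (π / l)`, `lamM = 2 cos (π / m)`. They are the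
`R^i Q^j`, for `1 ≤ i < m` and `1 ≤ j < l`, in lexicographic order of `(i, j)`, which is the order
of the intervals; those in an odd place (counting from 1) are multiplied by `F` on the right. -/
def hecke (l : ℕ) (lamL lamM : L) (a : ℕ) : GL (Fin 2) L :=
  matR lamM ^ (a / (l - 1) + 1) * matQ lamL ^ (a % (l - 1) + 1) * (if Even a then matF else 1)

/-- The matrices for `(l, ∞, ∞)`, with `β = 2 + 2 cos (π / l)`: in the order of the intervals, they
are `M J, (M P) J, (M P) M J, (M P)² J, …, (M P)^(l-1) M J`, where `M = M_β` and `P = P_1`. -/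
def twoCusps (β : L) (a : ℕ) : GL (Fin 2) L :=
  if Even a then (matM β * matP 1) ^ (a / 2) * matM β * matJ
  else (matM β * matP 1) ^ (a / 2 + 1) * matJ

/-- `U_1 = P_γ`, `U_2 = P_γ M_δ`, `U_3 = P_γ M_δ P_γ`. -/
def matU (γ δ : L) (i : ℕ) : GL (Fin 2) L :=
  if i = 1 then matP γ else if i = 2 then matP γ * matM δ else matP γ * matM δ * matP γ

/-- `V_{2q} = (M_β P_α)^q` and `V_{2q+1} = (M_β P_α)^q M_β`. -/
def matV (α β : L) (j : ℕ) : GL (Fin 2) L :=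
  (matM β * matP α) ^ (j / 2) * (if Even j then 1 else matM β)

/-- The matrices for `(4, 6, ∞)` and `(4, 12, ∞)`, in the order of the intervals:
`V_1 U_3, V_1 U_2, V_1 U_1, V_2 U_1, V_2 U_2, V_2 U_3, V_3 U_3, V_3 U_2, V_3 U_1, …`. -/
def reflGroup (α β γ δ : L) (a : ℕ) : GL (Fin 2) L :=
  matV α β (a / 3 + 1) * matU γ δ (if Even (a / 3) then 3 - a % 3 else a % 3 + 1)

end Matrices

/-- The nine commensurability classes of noncocompact triangle groups of quadratic
invariant trace field, each with its algorithm. -/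
inductive Case : Type
  /-- `(2, 5, ∞)` -/
  | tri_2_5
  /-- `(3, 4, ∞)` -/
  | tri_3_4
  /-- `(3, 5, ∞)` -/
  | tri_3_5
  /-- `(3, 6, ∞)` -/
  | tri_3_6
  /-- `(4, ∞, ∞)` -/
  | tri_4_inf
  /-- `(5, ∞, ∞)` -/
  | tri_5_inf
  /-- `(6, ∞, ∞)` -/
  | tri_6_inf
  /-- `(4, 6, ∞)` -/
  | tri_4_6
  /-- `(4, 12, ∞)` -/
  | tri_4_12

namespace Case

/-- The invariant trace field is `ℚ(√D)` for this `D`. -/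
def radicand : Case → ℕ
  | tri_2_5 => 5
  | tri_3_4 => 2
  | tri_3_5 => 5
  | tri_3_6 => 3
  | tri_4_inf => 2
  | tri_5_inf => 5
  | tri_6_inf => 3
  | tri_4_6 => 6
  | tri_4_12 => 3

/-- The alphabet has `r = lastDigit + 1` digits, numbered from `0`. -/
def lastDigit : Case → ℕ
  | tri_2_5 => 3
  | tri_3_4 => 5
  | tri_3_5 => 7
  | tri_3_6 => 9
  | tri_4_inf => 6
  | tri_5_inf => 8
  | tri_6_inf => 10
  | tri_4_6 => 14
  | tri_4_12 => 32

instance instNonsquare (c : Case) :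
    Fact (∀ q : ℚ, q ^ 2 ≠ (c.radicand : ℚ) + 0 * q) := by
  refine ⟨fun q hq => ?_⟩
  have h : IsSquare (c.radicand : ℚ) := ⟨q, by rw [← pow_two, hq]; ring⟩
  rw [Rat.isSquare_natCast_iff] at h
  obtain ⟨k, hk⟩ := h
  have hk3 : k < 3 := by
    by_contra hlt
    have : 3 * 3 ≤ k * k := Nat.mul_le_mul (by omega) (by omega)
    cases c <;> simp only [radicand] at hk <;> omega
  interval_cases k <;> cases c <;> simp [radicand] at hk

/-- The invariant trace field. -/
abbrev K (c : Case) : Type := QuadField c.radicand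

/-- The given embedding of the field in `ℝ`. -/
abbrev σ (c : Case) : c.K →+* ℝ := embed c.radicand

/-- The conjugate embedding. -/
abbrev σ' (c : Case) : c.K →+* ℝ := embedConj c.radicand

/-- The defining matrices, in the order of the intervals. Recall that `⟨x, y⟩` is `x + y √D`, and
that `2 cos (π / l)` equals `0, 1, √2, (1 + √5) / 2, √3` for `l = 2, 3, 4, 5, 6`. -/
def matrices : (c : Case) → ℕ → GL (Fin 2) c.K
  | tri_2_5 => hecke 2 0 ⟨1 / 2, 1 / 2⟩
  | tri_3_4 => hecke 3 1 ⟨0, 1⟩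
  | tri_3_5 => hecke 3 1 ⟨1 / 2, 1 / 2⟩
  | tri_3_6 => hecke 3 1 ⟨0, 1⟩
  | tri_4_inf => twoCusps ⟨2, 1⟩
  | tri_5_inf => twoCusps ⟨5 / 2, 1 / 2⟩
  | tri_6_inf => twoCusps ⟨2, 1⟩
  | tri_4_6 => reflGroup ⟨3, -1⟩ ⟨3, 1⟩ ⟨2, -1⟩ ⟨-2, -1⟩
  | tri_4_12 => reflGroup 1 ⟨2, 1⟩ ⟨1, -1⟩ ⟨-1, -1⟩

/-- The matrices `A_1, …, A_r`, indexed by the alphabet `0, …, r - 1`. -/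
def A (c : Case) (a : Fin (c.lastDigit + 1)) : GL (Fin 2) c.K := c.matrices a

/-- The Gauss map, on the projective line over the field. -/
abbrev T (c : Case) : OnePoint c.K → OnePoint c.K := gaussMap c.σ c.A

end Case

end QuadGauss

end

/-! Height decrease. Let `P = A_{b₀} ⋯ A_{b_{u-1}}` be the matrix of a decreasing block. If an orbit
runs through the block from `α` to `β`, then `α = P * β` with `β` in `I_{b_u}`. Since `P` has
integral entries and determinant `±1`, the finite places contribute equally to the heights of `β`
and `P * β` (`finHeight_mul`). At the given real place, the sup norm of the homogeneous coordinates
is multiplied by `f_P(β)`, which is at least `t(P)` because `β` lies in the closure of `E♯(P)`. At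
the conjugate place it is divided by at most `t(P)`, which is the sup operator norm of the inverse
of the conjugate of `P`. Hence `H(β) ≤ H(P * β)`. Equality forces equality at both real places. If
`P` has a zero entry, then `β` is a common boundary point and condition (iii) forbids this.
Otherwise, equality in a triangle inequality yields `P * β = 1`, so `β` has height one and is `0`
(`height_block`).

Completeness. This is a finite exact computation in the ring of integers (`searchTree_eq_true`),
although parabolic digits may be repeated arbitrarily often. A parabolic matrix is `B = 1 + N` with
`N² = 0`, so `M B^(k+1) = M B + k M N`. All words that differ only in the lengths of their parabolic
runs thus have matrices in one cone, an apex plus sums of finitely many generators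
(`InCone.mul_pow`). The growth condition compares a row of `M B` with `t(M)` times a row of `B`;
since `t` is subadditive, it suffices to check the apex and the generators (`rowCheck_spec`). A
block is then read off a path in the tree (`exists_block_of_search`).

Parabolic fixed points. The intervals cover `[0, ∞]`, and at common points they define the same
value of `T` (`exists_mem_interval`, `T_eq`). An itinerary without parabolic tail splits into blocks
(`exists_splitting`), along which heights would decrease strictly forever, contrary to Northcott's
theorem. With a parabolic tail, the orbit has reached `∞` or `0`. -/

namespace QuadGauss

/-! ### Exact arithmetic, decidable checks and the search -/

/-- The order `ℤ[ω]`, with `ω² = a + b ω`. -/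
abbrev ZW (a b : ℤ) : Type := QuadraticAlgebra ℤ a b

namespace ZW

variable {a b : ℤ}

/-- The conjugate. -/
def conj (z : ZW a b) : ZW a b := ⟨z.re + b * z.im, -z.im⟩

/-- Decides whether the real number `z.re + z.im * ω`, with `ω` the larger root, is nonnegative. -/
def nonneg (z : ZW a b) : Bool :=
  let u := 2 * z.re + b * z.im
  if 0 ≤ u then
    if 0 ≤ z.im then true else (b * b + 4 * a) * (z.im * z.im) ≤ u * u
  else if 0 ≤ z.im then u * u ≤ (b * b + 4 * a) * (z.im * z.im) else false

/-- Decides positivity of a real number. -/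
def pos (z : ZW a b) : Bool := !nonneg (-z)

/-- The absolute value of a real number. -/
def abs (z : ZW a b) : ZW a b := if nonneg z then z else -z

/-- The maximum of two real numbers. -/
def max (z w : ZW a b) : ZW a b := if nonneg (z - w) then z else w

end ZW

/-- Explicit two by two matrices. -/
@[ext]
structure Mat (R : Type) where
  /-- Upper left entry. -/
  a : R
  /-- Upper right entry. -/
  b : R
  /-- Lower left entry. -/
  c : R
  /-- Lower right entry. -/
  d : R

namespace Mat

section Ring

variable {R : Type} [CommRing R]

/-- The product of two matrices. -/
def mul (A B : Mat R) : Mat R :=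
  ⟨A.a * B.a + A.b * B.c, A.a * B.b + A.b * B.d, A.c * B.a + A.d * B.c, A.c * B.b + A.d * B.d⟩

/-- The identity matrix. -/
def one : Mat R := ⟨1, 0, 0, 1⟩

/-- The opposite matrix. -/
def neg (A : Mat R) : Mat R := ⟨-A.a, -A.b, -A.c, -A.d⟩

/-- The matrix `A - 1`. -/
def subOne (A : Mat R) : Mat R := ⟨A.a - 1, A.b, A.c, A.d - 1⟩

/-- The powers of a matrix. -/
def pow (A : Mat R) : ℕ → Mat R
  | 0 => one
  | n + 1 => (pow A n).mul A

/-- The determinant. -/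
def det (A : Mat R) : R := A.a * A.d - A.b * A.c

/-- The adjugate. -/
def adj (A : Mat R) : Mat R := ⟨A.d, -A.b, -A.c, A.a⟩

/-- The matrix `hecke l lamL lamM i`. -/
def hecke (l : ℕ) (lamL lamM : R) (i : ℕ) : Mat R :=
  ((pow ⟨0, 1, -1, lamM⟩ (i / (l - 1) + 1)).mul (pow ⟨lamL, 1, -1, 0⟩ (i % (l - 1) + 1))).mul
    (if i % 2 = 0 then ⟨0, 1, 1, 0⟩ else one)

/-- The matrix `twoCusps β i`. -/
def twoCusps (β : R) (i : ℕ) : Mat R :=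
  let M : Mat R := ⟨1, 0, β, -1⟩
  let P : Mat R := ⟨-1, 1, 0, 1⟩
  let J : Mat R := ⟨-1, 0, 0, 1⟩
  if i % 2 = 0 then ((pow (M.mul P) (i / 2)).mul M).mul J else (pow (M.mul P) (i / 2 + 1)).mul J

/-- The matrix `matU γ δ i`. -/
def matU (γ δ : R) (i : ℕ) : Mat R :=
  let P : Mat R := ⟨-1, γ, 0, 1⟩
  let M : Mat R := ⟨1, 0, δ, -1⟩
  if i = 1 then P else if i = 2 then P.mul M else (P.mul M).mul P

/-- The matrix `matV α β j`. -/
def matV (α β : R) (j : ℕ) : Mat R :=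
  let M : Mat R := ⟨1, 0, β, -1⟩
  let P : Mat R := ⟨-1, α, 0, 1⟩
  (pow (M.mul P) (j / 2)).mul (if j % 2 = 0 then one else M)

/-- The matrix `reflGroup α β γ δ i`. -/
def reflGroup (α β γ δ : R) (i : ℕ) : Mat R :=
  (matV α β (i / 3 + 1)).mul (matU γ δ (if (i / 3) % 2 = 0 then 3 - i % 3 else i % 3 + 1))

end Ring

variable {a b : ℤ}

/-- The threshold of a matrix. -/
def thr (A : Mat (ZW a b)) : ZW a b :=
  (A.a.conj.abs + A.c.conj.abs).max (A.b.conj.abs + A.d.conj.abs)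

/-- The matrix or its opposite, the one with nonnegative entries if possible. -/
def normalize (A : Mat (ZW a b)) : Mat (ZW a b) :=
  if A.a.nonneg && A.b.nonneg && A.c.nonneg && A.d.nonneg then A else A.neg

/-- Decides whether all entries are nonnegative. -/
def nonneg (A : Mat (ZW a b)) : Bool := A.a.nonneg && A.b.nonneg && A.c.nonneg && A.d.nonneg

/-- Decides whether all entries are positive. -/
def pos (A : Mat (ZW a b)) : Bool := A.a.pos && A.b.pos && A.c.pos && A.d.pos

/-- The rows of a matrix. -/
def row (A : Mat (ZW a b)) (i : Bool) : ZW a b × ZW a b := if i then (A.c, A.d) else (A.a, A.b)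

/-- Decides whether `x ≥ t y` for the vectors `x` and `y`. -/
def rowGe (x : ZW a b × ZW a b) (t : ZW a b) (y : ZW a b × ZW a b) : Bool :=
  (x.1 - t * y.1).nonneg && (x.2 - t * y.2).nonneg

/-- Decides whether `x ≥ t y` for the vectors `x` and `y`, with strict inequality somewhere. -/
def rowGt (x : ZW a b × ZW a b) (t : ZW a b) (y : ZW a b × ZW a b) : Bool :=
  rowGe x t y && ((x.1 - t * y.1).pos || (x.2 - t * y.2).pos)

/-- Decides whether the row of `A` with the given index is the larger one. -/
def dominates (A : Mat (ZW a b)) (i : Bool) : Bool :=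
  ((A.row i).1 - (A.row (!i)).1).nonneg && ((A.row i).2 - (A.row (!i)).2).nonneg

/-- Decides whether `row ρ (P B) ≥ t(P) row κ B` for `P` in the cone of `G` and `Gs`. -/
def rowCheck (G : Mat (ZW a b)) (Gs : List (Mat (ZW a b))) (B : Mat (ZW a b)) (κ ρ : Bool) : Bool :=
  rowGt ((G.mul B).row ρ) G.thr (B.row κ) &&
    Gs.all fun G' => rowGe ((G'.mul B).row ρ) G'.thr (B.row κ)

/-- Decides whether the matrices in the cone have positive entries, or a certain shape. -/
def shapeCheck (G : Mat (ZW a b)) (Gs : List (Mat (ZW a b))) : Bool :=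
  G.pos ||
  (G.a == 0 && G.b == 1 && G.c == 1 && (G.d - 1).pos &&
    Gs.all fun G' => G'.a == 0 && G'.b == 0 && G'.c == 0) ||
  (G.a == 1 && G.b == 0 && (G.c - 1).pos && G.d == 1 &&
    Gs.all fun G' => G'.a == 0 && G'.b == 0 && G'.d == 0)

/-- Decides whether each word with matrix in the cone can be completed to a block by the digit
with the matrix `B`. -/
def blockCheck (G : Mat (ZW a b)) (Gs : List (Mat (ZW a b))) (B : Mat (ZW a b)) (κ : Bool) : Bool :=
  rowCheck G Gs B κ false || rowCheck G Gs B κ true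

end Mat

/-- The search tree. -/
def search {a b : ℤ} (n : ℕ) (par : ℕ → Bool) (A : ℕ → Mat (ZW a b)) (κ : ℕ → Bool) :
    ℕ → ℕ → Mat (ZW a b) → List (Mat (ZW a b)) → Bool
  | 0, _, _, _ => false
  | k + 1, mode, G, Gs =>
    let s := G.shapeCheck Gs
    (List.range (n + 1)).all fun i =>
      -- `mode` is the digit of the run just completed, which cannot come next because runs are
      -- taken maximal; the value `n + 1` excludes nothing.
      i == mode || (i != n && s && G.blockCheck Gs (A i) (κ i)) ||
      if par i then
        -- One step consumes a whole run: its first power moves the apex, and each further power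
        -- adds a multiple of `B - 1`.
        search n par A κ k i (G.mul (A i))
          (Gs.map (fun G' => G'.mul (A i)) ++ (G :: Gs).map (fun G' => G'.mul (A i).subOne))
      else search n par A κ k (n + 1) (G.mul (A i)) (Gs.map fun G' => G'.mul (A i))

namespace Case

/-- The ring of integers is `ℤ[ω]`, with `ω² = a + b ω`, for this `a`. -/
def ca : Case → ℤ
  | tri_2_5 => 1
  | tri_3_4 => 2
  | tri_3_5 => 1
  | tri_3_6 => 3
  | tri_4_inf => 2
  | tri_5_inf => 1
  | tri_6_inf => 3
  | tri_4_6 => 6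
  | tri_4_12 => 3

/-- The ring of integers is `ℤ[ω]`, with `ω² = a + b ω`, for this `b`. -/
def cb : Case → ℤ
  | tri_2_5 => 1
  | tri_3_4 => 0
  | tri_3_5 => 1
  | tri_3_6 => 0
  | tri_4_inf => 0
  | tri_5_inf => 1
  | tri_6_inf => 0
  | tri_4_6 => 0
  | tri_4_12 => 0

/-- The defining matrices over the ring of integers. -/
def mats : (c : Case) → ℕ → Mat (ZW c.ca c.cb)
  | tri_2_5 => Mat.hecke 2 0 ⟨0, 1⟩
  | tri_3_4 => Mat.hecke 3 1 ⟨0, 1⟩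
  | tri_3_5 => Mat.hecke 3 1 ⟨0, 1⟩
  | tri_3_6 => Mat.hecke 3 1 ⟨0, 1⟩
  | tri_4_inf => Mat.twoCusps ⟨2, 1⟩
  | tri_5_inf => Mat.twoCusps ⟨2, 1⟩
  | tri_6_inf => Mat.twoCusps ⟨2, 1⟩
  | tri_4_6 => Mat.reflGroup ⟨3, -1⟩ ⟨3, 1⟩ ⟨2, -1⟩ ⟨-2, -1⟩
  | tri_4_12 => Mat.reflGroup 1 ⟨2, 1⟩ ⟨1, -1⟩ ⟨-1, -1⟩

/-- The defining matrices with nonnegative entries. -/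
def nmats (c : Case) (i : ℕ) : Mat (ZW c.ca c.cb) := (c.mats i).normalize

/-- The row of a defining matrix that is the larger one. -/
def dom (c : Case) (i : ℕ) : Bool := !(c.nmats i).dominates false

/-- The digits whose powers form parabolic runs. -/
def par (c : Case) (i : ℕ) : Bool :=
  i == c.lastDigit || (i == 0 && (c.nmats 0).det == 1)

/-- The search tree of the algorithm. -/
def searchTree (c : Case) : Bool :=
  search c.lastDigit c.par c.nmats c.dom 14 c.lastDigit Mat.one []

end Case

/-! ### Correctness of the exact arithmetic -/

namespace ZW

variable {a b : ℤ}

/-- The real value of an element of `ℤ[ω]`. -/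
noncomputable def val (z : ZW a b) : ℝ := z.re + z.im * ((b + √((b * b + 4 * a : ℤ) : ℝ)) / 2)

/-- Twice the value is `u + y √Δ` with `u = 2 re + b im`, `y = im` and `Δ = b² + 4a`. When `u` and
`y` have opposite signs, comparing `u²` with `Δ y²` decides. -/
theorem nonneg_iff (h : 0 ≤ b * b + 4 * a) (z : ZW a b) : z.nonneg = true ↔ 0 ≤ z.val := by
  have hs0 := Real.sqrt_nonneg ((b * b + 4 * a : ℤ) : ℝ)
  have hs : √((b * b + 4 * a : ℤ) : ℝ) ^ 2 = ((b * b + 4 * a : ℤ) : ℝ) :=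
    Real.sq_sqrt (by exact_mod_cast h)
  have hv : z.val = ((2 * z.re + b * z.im : ℤ) + (z.im : ℝ) * √((b * b + 4 * a : ℤ) : ℝ)) / 2 := by
    simp only [val]; push_cast; ring
  rw [hv]
  unfold nonneg
  generalize 2 * z.re + b * z.im = u
  generalize z.im = y
  generalize b * b + 4 * a = Δ at *
  generalize √(Δ : ℝ) = s at *
  have key : (0 : ℝ) ≤ ((u : ℝ) + y * s) / 2 ↔ 0 ≤ (u : ℝ) + y * s := by
    constructor <;> intro h <;> linarith
  rw [key]
  have hsq : (y * s) ^ 2 = Δ * (y * y) := by rw [mul_pow, hs]; ring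
  by_cases hu : 0 ≤ u
  · have hu' : (0 : ℝ) ≤ u := by exact_mod_cast hu
    by_cases hy : 0 ≤ y
    · have hy' : (0 : ℝ) ≤ y := by exact_mod_cast hy
      simp only [hu, hy, if_true, true_iff]
      positivity
    · have hy' : (y : ℝ) ≤ 0 := by exact_mod_cast (not_le.1 hy).le
      simp only [hu, hy, if_true, if_false, decide_eq_true_eq]
      have h1 : 0 ≤ -(y * s) := by nlinarith
      rw [← @Int.cast_le ℝ]
      push_cast
      rw [← hsq, ← neg_sq, ← pow_two, pow_le_pow_iff_left₀ h1 hu' two_ne_zero]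
      constructor <;> intro h <;> linarith
  · have hu' : (u : ℝ) < 0 := by exact_mod_cast (not_le.1 hu)
    by_cases hy : 0 ≤ y
    · have hy' : (0 : ℝ) ≤ y := by exact_mod_cast hy
      simp only [hu, hy, if_true, if_false, decide_eq_true_eq]
      have h1 : 0 ≤ y * s := by positivity
      rw [← @Int.cast_le ℝ]
      push_cast
      rw [← hsq, ← pow_two, ← neg_sq (u : ℝ),
        pow_le_pow_iff_left₀ (by linarith) h1 two_ne_zero]
      constructor <;> intro h <;> linarith
    · have hy' : (y : ℝ) ≤ 0 := by exact_mod_cast (not_le.1 hy).le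
      simp only [hu, hy, if_false, false_iff, not_le, Bool.false_eq_true]
      nlinarith

theorem val_neg (z : ZW a b) : (-z).val = -z.val := by
  simp [val]; ring

theorem pos_iff (h : 0 ≤ b * b + 4 * a) (z : ZW a b) : z.pos = true ↔ 0 < z.val := by
  have := nonneg_iff h (-z)
  rw [val_neg] at this
  rw [pos, Bool.not_eq_true', ← Bool.not_eq_true, this, not_le, neg_lt_zero]

theorem val_abs (h : 0 ≤ b * b + 4 * a) (z : ZW a b) : z.abs.val = |z.val| := by
  unfold abs
  split_ifs with hz
  · rw [abs_of_nonneg ((nonneg_iff h z).1 hz)]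
  · rw [nonneg_iff h z, not_le] at hz
    rw [val_neg, abs_of_neg hz]

end ZW

namespace Case

theorem disc_nonneg (c : Case) : 0 ≤ c.cb * c.cb + 4 * c.ca := by cases c <;> decide

/-- The generator of the ring of integers. -/
def omega (c : Case) : c.K := ⟨c.cb / 2, if c.cb = 1 then 1 / 2 else 1⟩

theorem mk_mul_self (D : ℕ) (p q : ℚ) (a b : ℤ) (h₁ : p * p + D * (q * q) = a + b * p)
    (h₂ : 2 * (p * q) = b * q) :
    (⟨p, q⟩ : QuadField D) * ⟨p, q⟩ = a • 1 + b • ⟨p, q⟩ := by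
  ext
  · simp
    linarith
  · simp
    linarith

theorem omega_mul_omega (c : Case) :
    c.omega * c.omega = c.ca • (1 : c.K) + c.cb • c.omega := by
  apply mk_mul_self <;> cases c <;> simp [radicand, ca, cb] <;> norm_num

/-- The embedding of the ring of integers. -/
noncomputable def phi (c : Case) : ZW c.ca c.cb →+* c.K :=
  (QuadraticAlgebra.lift (R := ℤ) (A := c.K) (a := c.ca) (b := c.cb)
    ⟨c.omega, c.omega_mul_omega⟩).toRingHom

theorem phi_apply (c : Case) (z : ZW c.ca c.cb) : c.phi z = z.re + z.im * c.omega := by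
  simp [phi, QuadraticAlgebra.lift]

theorem isIntegral_omega (c : Case) : IsIntegral ℤ c.omega := by
  refine ⟨Polynomial.X ^ 2 - (Polynomial.C c.cb * Polynomial.X + Polynomial.C c.ca), ?_, ?_⟩
  · apply Polynomial.monic_X_pow_sub
    compute_degree!
  · have := c.omega_mul_omega
    simp only [zsmul_eq_mul, mul_one] at this
    rw [Polynomial.eval₂_sub, Polynomial.eval₂_add, Polynomial.eval₂_mul, Polynomial.eval₂_C,
      Polynomial.eval₂_C, Polynomial.eval₂_X_pow, Polynomial.eval₂_X, pow_two, this]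
    simp [add_comm]

theorem isIntegral_phi (c : Case) (z : ZW c.ca c.cb) : IsIntegral ℤ (c.phi z) := by
  rw [phi_apply]
  exact (isIntegral_algebraMap (x := z.re) (R := ℤ) (A := c.K)).add
    ((isIntegral_algebraMap (x := z.im) (R := ℤ) (A := c.K)).mul c.isIntegral_omega)

/-- The discriminant is `D = 5` when `ω` is the golden ratio, and `4 D` when `ω = √D`. -/
theorem sqrt_disc (c : Case) : √((c.cb * c.cb + 4 * c.ca : ℤ) : ℝ) =
    2 * (((if c.cb = 1 then 1 / 2 else 1 : ℚ)) : ℝ) * √(c.radicand : ℝ) := by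
  have h : ∀ x : ℝ, 0 ≤ x → √(4 * x) = 2 * √x := by
    intro x hx
    rw [Real.sqrt_mul (by norm_num), show (4 : ℝ) = 2 ^ 2 by norm_num,
      Real.sqrt_sq (by norm_num)]
  cases c <;> simp [radicand, ca, cb] <;> (rw [← h _ (by norm_num)]; norm_num)

theorem embed_phi (c : Case) (z : ZW c.ca c.cb) : c.σ (c.phi z) = z.val := by
  rw [phi_apply, map_add, map_mul, map_intCast, map_intCast, embed_apply, ZW.val, sqrt_disc]
  simp only [omega]
  push_cast
  ring

theorem embedConj_phi (c : Case) (z : ZW c.ca c.cb) : c.σ' (c.phi z) = z.conj.val := by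
  rw [phi_apply, map_add, map_mul, map_intCast, map_intCast, embedConj_apply, ZW.val, sqrt_disc]
  simp only [omega, ZW.conj]
  push_cast
  ring

theorem embed_one (c : Case) : ZW.val (1 : ZW c.ca c.cb) = 1 := by
  rw [← embed_phi]; simp

theorem val_add (c : Case) (z w : ZW c.ca c.cb) : (z + w).val = z.val + w.val := by
  simp only [← embed_phi, map_add]

theorem val_sub (c : Case) (z w : ZW c.ca c.cb) : (z - w).val = z.val - w.val := by
  simp only [← embed_phi, map_sub]

theorem val_mul (c : Case) (z w : ZW c.ca c.cb) : (z * w).val = z.val * w.val := by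
  simp only [← embed_phi, map_mul]

theorem val_max (c : Case) (z w : ZW c.ca c.cb) : (z.max w).val = max z.val w.val := by
  unfold ZW.max
  have h := ZW.nonneg_iff c.disc_nonneg (z - w)
  rw [val_sub, sub_nonneg] at h
  split_ifs with hz
  · exact (max_eq_left (h.1 hz)).symm
  · rw [h, not_le] at hz
    exact (max_eq_right hz.le).symm

end Case

/-! ### Explicit matrices and the given matrices -/

namespace Mat

/-- The matrix in Mathlib's sense. -/
def toMatrix {R : Type} (A : Mat R) : Matrix (Fin 2) (Fin 2) R := !![A.a, A.b; A.c, A.d]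

/-- Application of a ring homomorphism to the entries. -/
def map {R S : Type} (f : R → S) (A : Mat R) : Mat S := ⟨f A.a, f A.b, f A.c, f A.d⟩

variable {R S : Type} [CommRing R] [CommRing S]

@[simp] theorem toMatrix_mul (A B : Mat R) : (A.mul B).toMatrix = A.toMatrix * B.toMatrix := by
  simp [toMatrix, mul]

@[simp] theorem toMatrix_one : (one : Mat R).toMatrix = 1 := by
  simp [toMatrix, one, Matrix.one_fin_two]

@[simp] theorem toMatrix_neg (A : Mat R) : A.neg.toMatrix = -A.toMatrix := by
  simp [toMatrix, neg]

@[simp] theorem toMatrix_pow (A : Mat R) (n : ℕ) : (A.pow n).toMatrix = A.toMatrix ^ n := by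
  induction n with
  | zero => simp [pow]
  | succ n ih => rw [pow, toMatrix_mul, ih, pow_succ]

variable (f : R →+* S)

@[simp] theorem map_mul' (A B : Mat R) : (A.mul B).map f = (A.map f).mul (B.map f) := by
  simp [map, mul]

@[simp] theorem map_one' : (one : Mat R).map f = one := by
  simp [map, one]

@[simp] theorem map_pow' (A : Mat R) (n : ℕ) : (A.pow n).map f = (A.map f).pow n := by
  induction n with
  | zero => simp [pow]
  | succ n ih => simp [pow, ih]

@[simp] theorem map_neg' (A : Mat R) : A.neg.map f = (A.map f).neg := by
  simp [map, neg]

@[simp] theorem map_mk (x y z w : R) : (⟨x, y, z, w⟩ : Mat R).map f = ⟨f x, f y, f z, f w⟩ := rfl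

theorem map_hecke (l : ℕ) (x y : R) (i : ℕ) :
    (hecke l x y i).map f = hecke l (f x) (f y) i := by
  unfold hecke
  split_ifs <;> simp

theorem map_twoCusps (x : R) (i : ℕ) : (twoCusps x i).map f = twoCusps (f x) i := by
  unfold twoCusps
  split_ifs <;> simp

theorem map_matU (x y : R) (i : ℕ) : (matU x y i).map f = matU (f x) (f y) i := by
  unfold matU
  split_ifs <;> simp

theorem map_matV (x y : R) (i : ℕ) : (matV x y i).map f = matV (f x) (f y) i := by
  unfold matV
  split_ifs <;> simp

theorem map_reflGroup (x y z w : R) (i : ℕ) :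
    (reflGroup x y z w i).map f = reflGroup (f x) (f y) (f z) (f w) i := by
  simp [reflGroup, map_matU, map_matV]

variable {L : Type} [Field L]

theorem toMatrix_hecke (l : ℕ) (x y : L) (i : ℕ) :
    (hecke l x y i).toMatrix = (QuadGauss.hecke l x y i).val := by
  simp only [hecke, QuadGauss.hecke, Nat.even_iff]
  split_ifs <;> simp [matR, matQ, matF, GeneralLinearGroup.mkOfDetNeZero] <;> simp [toMatrix]

theorem toMatrix_twoCusps (x : L) (i : ℕ) :
    (twoCusps x i).toMatrix = (QuadGauss.twoCusps x i).val := by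
  simp only [twoCusps, QuadGauss.twoCusps, Nat.even_iff]
  split_ifs <;> simp [matM, matP, matJ, GeneralLinearGroup.mkOfDetNeZero] <;> simp [toMatrix]

theorem toMatrix_matU (x y : L) (i : ℕ) :
    (matU x y i).toMatrix = (QuadGauss.matU x y i).val := by
  simp only [matU, QuadGauss.matU]
  split_ifs <;> simp [matM, matP, GeneralLinearGroup.mkOfDetNeZero] <;> simp [toMatrix]

theorem toMatrix_matV (x y : L) (i : ℕ) :
    (matV x y i).toMatrix = (QuadGauss.matV x y i).val := by
  simp only [matV, QuadGauss.matV, Nat.even_iff]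
  split_ifs <;> simp [matM, matP, GeneralLinearGroup.mkOfDetNeZero] <;> simp [toMatrix]

theorem toMatrix_reflGroup (x y z w : L) (i : ℕ) :
    (reflGroup x y z w i).toMatrix = (QuadGauss.reflGroup x y z w i).val := by
  simp only [reflGroup, QuadGauss.reflGroup, Nat.even_iff, toMatrix_mul, toMatrix_matU,
    toMatrix_matV, Units.val_mul]

end Mat

namespace Case

theorem phi_mk (c : Case) (x y : ℤ) :
    c.phi ⟨x, y⟩ = ⟨x + y * (c.cb / 2), y * (if c.cb = 1 then 1 / 2 else 1)⟩ := by
  rw [phi_apply]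
  ext
  · simp [omega]
  · simp [omega]

theorem toMatrix_mats (c : Case) (i : ℕ) :
    ((c.mats i).map c.phi).toMatrix = (c.matrices i).val := by
  cases c <;>
  simp only [mats, matrices, Mat.map_hecke, Mat.toMatrix_hecke, Mat.map_twoCusps,
    Mat.toMatrix_twoCusps, Mat.map_reflGroup, Mat.toMatrix_reflGroup, map_zero, map_one] <;>
  congr 2 <;> refine (phi_mk _ _ _).trans ?_ <;> ext <;> simp [cb] <;> norm_num

end Case

/-! ### Homogeneous coordinates on the projective line -/

section Projective

variable {L : Type} [Field L] [DecidableEq L]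

/-- The point of the projective line with the given homogeneous coordinates. -/
def ofPair (p q : L) : OnePoint L := if q = 0 then ∞ else ((p / q : L) : OnePoint L)

theorem ofPair_one_zero : ofPair (1 : L) 0 = ∞ := by simp [ofPair]

theorem ofPair_one (k : L) : ofPair k 1 = (k : OnePoint L) := by simp [ofPair]

theorem exists_ofPair (x : OnePoint L) : ∃ p q : L, (p ≠ 0 ∨ q ≠ 0) ∧ x = ofPair p q := by
  cases x with
  | infty => exact ⟨1, 0, by simp, ofPair_one_zero.symm⟩
  | coe k => exact ⟨k, 1, by simp, (ofPair_one k).symm⟩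

theorem ofPair_eq_iff {p q p' q' : L} (h : p ≠ 0 ∨ q ≠ 0) (h' : p' ≠ 0 ∨ q' ≠ 0) :
    ofPair p q = ofPair p' q' ↔ p * q' = p' * q := by
  unfold ofPair
  by_cases hq : q = 0
  · have hp : p ≠ 0 := by simpa [hq] using h
    by_cases hq' : q' = 0 <;> simp [hq, hq', hp]
  · by_cases hq' : q' = 0
    · have hp' : p' ≠ 0 := by simpa [hq'] using h'
      simp [hq, hq', hp']
    · simp only [hq, hq', if_false, OnePoint.coe_eq_coe]
      rw [div_eq_div_iff hq hq']

theorem ofPair_mul (p q : L) {t : L} (ht : t ≠ 0) : ofPair (t * p) (t * q) = ofPair p q := by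
  unfold ofPair
  by_cases hq : q = 0
  · simp [hq]
  · simp [hq, ht, mul_div_mul_left]

theorem smul_pair_ne_zero (g : GL (Fin 2) L) {p q : L} (h : p ≠ 0 ∨ q ≠ 0) :
    g 0 0 * p + g 0 1 * q ≠ 0 ∨ g 1 0 * p + g 1 1 * q ≠ 0 := by
  by_contra! hc
  have hd : g 0 0 * g 1 1 - g 0 1 * g 1 0 ≠ 0 := by
    have := g.det_ne_zero
    rwa [det_fin_two] at this
  have h1 : (g 0 0 * g 1 1 - g 0 1 * g 1 0) * p = 0 := by linear_combination g 1 1 * hc.1 - g 0 1 * hc.2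
  have h2 : (g 0 0 * g 1 1 - g 0 1 * g 1 0) * q = 0 := by linear_combination g 0 0 * hc.2 - g 1 0 * hc.1
  simp only [mul_eq_zero, hd, false_or] at h1 h2
  simp [h1, h2] at h

theorem smul_ofPair (g : GL (Fin 2) L) {p q : L} (h : p ≠ 0 ∨ q ≠ 0) :
    g • ofPair p q = ofPair (g 0 0 * p + g 0 1 * q) (g 1 0 * p + g 1 1 * q) := by
  by_cases hq : q = 0
  · have hp : p ≠ 0 := by simpa [hq] using h
    simp [ofPair, hq, OnePoint.smul_infty_eq_ite, hp, mul_div_mul_right]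
  · have h1 : g 1 0 * (p / q) + g 1 1 = (g 1 0 * p + g 1 1 * q) / q := by field_simp
    have h2 : g 0 0 * (p / q) + g 0 1 = (g 0 0 * p + g 0 1 * q) / q := by field_simp
    simp only [ofPair, hq, if_false, OnePoint.smul_some_eq_ite, h1, h2, div_eq_zero_iff, or_false]
    split_ifs with h0
    · rfl
    · rw [div_div_div_cancel_right₀ hq]

theorem map_ofPair {M : Type} [Field M] [DecidableEq M] (f : L →+* M) (p q : L) :
    OnePoint.map f (ofPair p q) = ofPair (f p) (f q) := by
  unfold ofPair
  by_cases hq : q = 0 <;> simp [hq]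

theorem inv_smul_eq_of_eq {g : GL (Fin 2) L} {x y : OnePoint L} (h : x = g • y) : g⁻¹ • x = y := by
  rw [h, inv_smul_smul]

end Projective

theorem ofPair_mem_baseInterval {p q : ℝ} : ofPair p q ∈ baseInterval ↔ 0 ≤ p * q := by
  unfold ofPair
  by_cases hq : q = 0
  · simp [hq, baseInterval]
  · have : 0 ≤ p * q ↔ 0 ≤ p / q := by
      rw [show p * q = p / q * (q * q) by field_simp]
      exact mul_nonneg_iff_of_pos_right (mul_self_pos.2 hq)
    simp [hq, baseInterval, this]

theorem coe_mem_baseInterval {y : ℝ} : (y : OnePoint ℝ) ∈ baseInterval ↔ 0 ≤ y := by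
  simp [baseInterval]

theorem infty_mem_baseInterval : (∞ : OnePoint ℝ) ∈ baseInterval := by
  simp [baseInterval]

theorem mem_interval_iff {L : Type} [Field L] [DecidableEq L] {σ : L →+* ℝ} {A : GL (Fin 2) L}
    {x : OnePoint L} :
    OnePoint.map σ x ∈ interval σ A ↔ OnePoint.map σ (A⁻¹ • x) ∈ baseInterval := by
  rw [OnePoint.map_smul, map_inv]
  constructor
  · rintro ⟨y, hy, h⟩
    rw [← h]
    simpa using hy
  · intro h
    exact ⟨_, h, by simp⟩

theorem isClosed_baseInterval : IsClosed baseInterval := by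
  rw [OnePoint.isClosed_iff_of_mem infty_mem_baseInterval]
  have : ((↑) : ℝ → OnePoint ℝ) ⁻¹' baseInterval = Set.Ici 0 := by
    ext y
    simp [coe_mem_baseInterval]
  rw [this]
  exact isClosed_Ici

/-! ### The intervals tile `[0, ∞]`, and the Gauss map on them -/

namespace Mat

variable {R : Type} [CommRing R]

/-- Two matrices agree up to sign. -/
def EqSign (A : Mat R) (M : Matrix (Fin 2) (Fin 2) R) : Prop :=
  M = A.toMatrix ∨ M = -A.toMatrix

end Mat

namespace Case

/-- The defining matrices over the field, with nonnegative entries. -/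
noncomputable def ent (c : Case) (i : ℕ) : Mat c.K := (c.nmats i).map c.phi

theorem matrices_eqSign (c : Case) (i : ℕ) : (c.ent i).EqSign (c.matrices i).val := by
  rw [← toMatrix_mats, ent, nmats, Mat.normalize]
  split_ifs
  · exact Or.inl rfl
  · right
    rw [Mat.map_neg', Mat.toMatrix_neg, neg_neg]

/-- The endpoints shared by consecutive intervals, and the nature of the first and last matrix. -/
def chainCheck (c : Case) : Bool :=
  let N := c.nmats
  ((List.range c.lastDigit).all fun i =>
    ((N i).det == 1 && (N (i + 1)).det == -1 &&
      (N i).a == (N (i + 1)).a && (N i).c == (N (i + 1)).c) ||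
    ((N i).det == -1 && (N (i + 1)).det == 1 &&
      (N i).b == (N (i + 1)).b && (N i).d == (N (i + 1)).d)) &&
  (((N 0).a == 1 && (N 0).b == 0 && (N 0).c.pos && (N 0).d == 1) ||
    ((N 0).a == 0 && (N 0).det == -1)) &&
  ((N c.lastDigit).a == 1 && (N c.lastDigit).b.pos && (N c.lastDigit).c == 0 &&
    (N c.lastDigit).d == 1)

/-- Signs of the entries. -/
def signCheck (c : Case) : Bool :=
  let N := c.nmats
  ((List.range (c.lastDigit + 1)).all fun i => (N i).nonneg) &&
  ((List.range c.lastDigit).all fun i => (N i).c.pos && (N i).d.pos && (N i).dominates (c.dom i))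

/-- Distinct intervals meet at most in a common endpoint. -/
def overlapCheck (c : Case) : Bool :=
  (List.range (c.lastDigit + 1)).all fun j => (List.range j).all fun i =>
    let C := (c.nmats i).adj.mul (c.nmats j)
    (-(C.a * C.c)).nonneg && (-(C.b * C.d)).nonneg && (-(C.a * C.d + C.b * C.c)).nonneg &&
    (((C.a * C.c) != 0 && ((C.b * C.d) != 0 || C.b == 0)) || (C.c == 0 && (C.b * C.d) != 0))

theorem chainCheck_eq_true (c : Case) : c.chainCheck = true := by
  cases c <;> decide +kernel

theorem signCheck_eq_true (c : Case) : c.signCheck = true := by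
  cases c <;> decide +kernel

theorem overlapCheck_eq_true (c : Case) : c.overlapCheck = true := by
  cases c <;> decide +kernel

end Case

namespace Case

variable (c : Case)

theorem nmats_nonneg {i : ℕ} (hi : i ≤ c.lastDigit) :
    0 ≤ (c.nmats i).a.val ∧ 0 ≤ (c.nmats i).b.val ∧ 0 ≤ (c.nmats i).c.val ∧
      0 ≤ (c.nmats i).d.val := by
  have h := c.signCheck_eq_true
  simp only [signCheck, Bool.and_eq_true, List.all_eq_true, List.mem_range, Mat.nonneg,
    ZW.nonneg_iff c.disc_nonneg] at h
  have := h.1 i (by omega)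
  tauto

theorem nmats_pos {i : ℕ} (hi : i < c.lastDigit) :
    0 < (c.nmats i).c.val ∧ 0 < (c.nmats i).d.val := by
  have h := c.signCheck_eq_true
  simp only [signCheck, Bool.and_eq_true, List.all_eq_true, List.mem_range,
    ZW.pos_iff c.disc_nonneg] at h
  have := h.2 i (by omega)
  tauto

theorem nmats_dominates {i : ℕ} (hi : i < c.lastDigit) :
    (c.nmats i).dominates (c.dom i) = true := by
  have h := c.signCheck_eq_true
  simp only [signCheck, Bool.and_eq_true, List.all_eq_true, List.mem_range] at h
  exact (h.2 i hi).2

/-- Orientations alternate along the chain. The right endpoint of an interval is `A * ∞` for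
determinant `1` and `A * 0` for determinant `-1`, so neighbours share a column. -/
theorem chain {i : ℕ} (hi : i < c.lastDigit) :
    ((c.nmats i).det = 1 ∧ (c.nmats (i + 1)).det = -1 ∧
      (c.nmats i).a = (c.nmats (i + 1)).a ∧ (c.nmats i).c = (c.nmats (i + 1)).c) ∨
    ((c.nmats i).det = -1 ∧ (c.nmats (i + 1)).det = 1 ∧
      (c.nmats i).b = (c.nmats (i + 1)).b ∧ (c.nmats i).d = (c.nmats (i + 1)).d) := by
  have h := c.chainCheck_eq_true
  simp only [chainCheck, Bool.and_eq_true, List.all_eq_true, List.mem_range, Bool.or_eq_true,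
    beq_iff_eq] at h
  have := h.1.1 i hi
  tauto

theorem nmats_zero :
    ((c.nmats 0).a = 1 ∧ (c.nmats 0).b = 0 ∧ 0 < (c.nmats 0).c.val ∧ (c.nmats 0).d = 1) ∨
      ((c.nmats 0).a = 0 ∧ (c.nmats 0).det = -1) := by
  have h := c.chainCheck_eq_true
  simp only [chainCheck, Bool.and_eq_true, Bool.or_eq_true, beq_iff_eq,
    ZW.pos_iff c.disc_nonneg] at h
  tauto

theorem nmats_last :
    (c.nmats c.lastDigit).a = 1 ∧ 0 < (c.nmats c.lastDigit).b.val ∧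
      (c.nmats c.lastDigit).c = 0 ∧ (c.nmats c.lastDigit).d = 1 := by
  have h := c.chainCheck_eq_true
  simp only [chainCheck, Bool.and_eq_true, beq_iff_eq, ZW.pos_iff c.disc_nonneg] at h
  tauto

theorem nmats_det {i : ℕ} (hi : i ≤ c.lastDigit) :
    (c.nmats i).det = 1 ∨ (c.nmats i).det = -1 := by
  rcases hi.lt_or_eq with hi | rfl
  · rcases c.chain hi with h | h <;> tauto
  · obtain ⟨h1, -, h2, h3⟩ := c.nmats_last
    left
    simp [Mat.det, h1, h2, h3]

theorem val_nmats_det {i : ℕ} (hi : i ≤ c.lastDigit) :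
    (c.nmats i).det.val = 1 ∨ (c.nmats i).det.val = -1 := by
  rcases c.nmats_det hi with h | h <;> simp [h, ZW.val_neg, embed_one]

theorem det_A (a : Fin (c.lastDigit + 1)) : (c.A a).val.det = c.phi (c.nmats a).det := by
  rcases c.matrices_eqSign a with h | h <;>
    simp [A, h, Mat.toMatrix, ent, Mat.map, Mat.det, det_fin_two]

theorem det_A_zero : ((c.A 0).val.det = 1 ∧ (c.nmats 0).det = 1) ∨
    ((c.A 0).val.det = -1 ∧ (c.nmats 0).det = -1) := by
  have := c.det_A 0
  simp only [Fin.val_zero] at this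
  rcases c.nmats_det (Nat.zero_le _) with h | h <;> simp [this, h]

/-- The action of a defining matrix in terms of its representative with nonnegative entries. -/
theorem smul_ofPair (a : Fin (c.lastDigit + 1)) {p q : c.K} (h : p ≠ 0 ∨ q ≠ 0) :
    c.A a • ofPair p q = ofPair (c.phi (c.nmats a).a * p + c.phi (c.nmats a).b * q)
      (c.phi (c.nmats a).c * p + c.phi (c.nmats a).d * q) := by
  rw [QuadGauss.smul_ofPair _ h]
  have e : ∀ i j, c.A a i j = (c.matrices a).val i j := fun _ _ => rfl
  rcases c.matrices_eqSign a with hs | hs <;>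
    simp only [e, hs, Mat.toMatrix, ent, Mat.map] <;> simp
  rw [← ofPair_mul _ _ (neg_ne_zero.2 one_ne_zero : (-1 : c.K) ≠ 0)]
  ring_nf

theorem adj_ne_zero (a : Fin (c.lastDigit + 1)) {p q : c.K} (h : p ≠ 0 ∨ q ≠ 0) :
    c.phi (c.nmats a).d * p - c.phi (c.nmats a).b * q ≠ 0 ∨
      c.phi (c.nmats a).a * q - c.phi (c.nmats a).c * p ≠ 0 := by
  by_contra! hc
  have hd : c.phi (c.nmats a).det ≠ 0 := by
    rw [← det_A]
    exact (c.A a).det_ne_zero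
  simp only [Mat.det, map_sub, map_mul] at hd
  have h1 := congrArg₂ (fun x y => c.phi (c.nmats a).a * x + c.phi (c.nmats a).b * y) hc.1 hc.2
  have h2 := congrArg₂ (fun x y => c.phi (c.nmats a).c * x + c.phi (c.nmats a).d * y) hc.1 hc.2
  have h1' : (c.phi (c.nmats a).a * c.phi (c.nmats a).d -
      c.phi (c.nmats a).b * c.phi (c.nmats a).c) * p = 0 := by linear_combination h1
  have h2' : (c.phi (c.nmats a).a * c.phi (c.nmats a).d -
      c.phi (c.nmats a).b * c.phi (c.nmats a).c) * q = 0 := by linear_combination h2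
  simp only [mul_eq_zero, hd, false_or] at h1' h2'
  simp [h1', h2'] at h

theorem inv_smul_ofPair (a : Fin (c.lastDigit + 1)) {p q : c.K} (h : p ≠ 0 ∨ q ≠ 0) :
    (c.A a)⁻¹ • ofPair p q = ofPair (c.phi (c.nmats a).d * p - c.phi (c.nmats a).b * q)
      (c.phi (c.nmats a).a * q - c.phi (c.nmats a).c * p) := by
  apply inv_smul_eq_of_eq
  rw [c.smul_ofPair a (c.adj_ne_zero a h)]
  have hd : c.phi (c.nmats a).det ≠ 0 := by
    rw [← det_A]
    exact (c.A a).det_ne_zero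
  rw [← ofPair_mul p q hd]
  simp only [Mat.det, map_sub, map_mul]
  ring_nf

theorem mem_interval_ofPair (a : Fin (c.lastDigit + 1)) {p q : c.K} (h : p ≠ 0 ∨ q ≠ 0) :
    OnePoint.map c.σ (ofPair p q) ∈ interval c.σ (c.A a) ↔
      0 ≤ ((c.nmats a).d.val * c.σ p - (c.nmats a).b.val * c.σ q) *
        ((c.nmats a).a.val * c.σ q - (c.nmats a).c.val * c.σ p) := by
  rw [mem_interval_iff, c.inv_smul_ofPair a h, map_ofPair, ofPair_mem_baseInterval]
  simp only [map_sub, map_mul, embed_phi]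

theorem val_eq_zero {z : ZW c.ca c.cb} : z.val = 0 ↔ z = 0 := by
  rw [← embed_phi, map_eq_zero]
  constructor
  · intro hz
    have hre := congrArg QuadraticAlgebra.re hz
    have him := congrArg QuadraticAlgebra.im hz
    rw [show z = ⟨z.re, z.im⟩ from rfl, phi_mk] at hre him
    have hz : z.im = 0 := by
      simp only [QuadraticAlgebra.im_zero] at him
      split_ifs at him <;> simpa using him
    rw [hz] at hre
    ext
    · simpa using hre
    · simpa using hz
  · rintro rfl
    simp

/-- Here `(u, v)` are coordinates of a point with respect to `I_j`, and the matrix carries them to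
coordinates with respect to `I_i`. The product of the latter is a quadratic form with nonpositive
coefficients, so each of its terms vanishes. Only an endpoint `0` or `∞` can remain, and the matrix
fixes it. -/
theorem cone_intersection {A B C D u v : ℝ} (h : 0 ≤ (A * u + B * v) * (C * u + D * v))
    (huv : 0 ≤ u * v) (h₁ : 0 ≤ -(A * C)) (h₂ : 0 ≤ -(B * D)) (h₃ : 0 ≤ -(A * D + B * C))
    (h₄ : (A * C ≠ 0 ∧ (B * D ≠ 0 ∨ B = 0)) ∨ (C = 0 ∧ B * D ≠ 0)) :
    (A * u + B * v) * v = u * (C * u + D * v) := by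
  have e : (A * u + B * v) * (C * u + D * v) =
      -(-(A * C) * (u * u) + -(B * D) * (v * v) + -(A * D + B * C) * (u * v)) := by ring
  have t1 := mul_nonneg h₁ (mul_self_nonneg u)
  have t2 := mul_nonneg h₂ (mul_self_nonneg v)
  have t3 := mul_nonneg h₃ huv
  have z1 : A * C * (u * u) = 0 := by linarith
  have z2 : B * D * (v * v) = 0 := by linarith
  rcases h₄ with ⟨hAC, hB⟩ | ⟨rfl, hBD⟩
  · have hu : u = 0 := by simpa [hAC] using z1
    rcases hB with hBD | rfl
    · have hv : v = 0 := by simpa [hBD] using z2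
      simp [hu, hv]
    · simp [hu]
  · have hv : v = 0 := by simpa [hBD] using z2
    simp [hv]

theorem inv_smul_eq_of_lt {i j : Fin (c.lastDigit + 1)} (hij : i < j) {x : OnePoint c.K}
    (hi : OnePoint.map c.σ x ∈ interval c.σ (c.A i))
    (hj : OnePoint.map c.σ x ∈ interval c.σ (c.A j)) : (c.A i)⁻¹ • x = (c.A j)⁻¹ • x := by
  obtain ⟨p, q, hpq, rfl⟩ := exists_ofPair x
  rw [c.mem_interval_ofPair _ hpq] at hi hj
  rw [c.inv_smul_ofPair _ hpq, c.inv_smul_ofPair _ hpq,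
    ofPair_eq_iff (c.adj_ne_zero _ hpq) (c.adj_ne_zero _ hpq)]
  apply c.σ.injective
  have hd := c.val_nmats_det (Nat.lt_succ_iff.1 j.2)
  have h := c.overlapCheck_eq_true
  simp only [overlapCheck, List.all_eq_true, List.mem_range, Bool.and_eq_true, Bool.or_eq_true,
    ZW.nonneg_iff c.disc_nonneg, bne_iff_ne, ne_eq, beq_iff_eq] at h
  obtain ⟨⟨⟨h1, h2⟩, h3⟩, h4⟩ := h j j.2 i hij
  simp only [map_sub, map_mul, embed_phi]
  simp only [← c.val_eq_zero] at h4
  simp only [Mat.adj, Mat.mul, Mat.det, ZW.val_neg, val_add, val_mul, val_sub] at h1 h2 h3 h4 hd ⊢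
  generalize (c.nmats i).a.val = a at *
  generalize (c.nmats i).b.val = b at *
  generalize (c.nmats i).c.val = e at *
  generalize (c.nmats i).d.val = d at *
  generalize (c.nmats j).a.val = a' at *
  generalize (c.nmats j).b.val = b' at *
  generalize (c.nmats j).c.val = e' at *
  generalize (c.nmats j).d.val = d' at *
  generalize c.σ p = p at *
  generalize c.σ q = q at *
  -- The product `adj(A_i) A_j adj(A_j)` is `det A_j` times `adj(A_i)`. In the sign condition this
  -- factor appears squared.
  have key : (a' * d' - b' * e') ^ 2 = 1 := by rcases hd with h | h <;> rw [h] <;> norm_num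
  have := cone_intersection (u := d' * p - b' * q) (v := a' * q - e' * p)
    (A := d * a' + -b * e') (B := d * b' + -b * d') (C := -e * a' + a * e')
    (D := -e * b' + a * d') ?_ hj h1 h2 h3 h4
  · rcases hd with h | h
    · linear_combination this + (-((d * p - b * q) * (a' * q - e' * p)) +
        (d' * p - b' * q) * (a * q - e * p)) * h
    · linear_combination -this + ((d * p - b * q) * (a' * q - e' * p) -
        (d' * p - b' * q) * (a * q - e * p)) * h
  · have := congrArg (· * ((d * p - b * q) * (a * q - e * p))) key
    simp only [one_mul] at this
    rw [← this] at hi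
    linarith [hi]

theorem inv_smul_eq_inv_smul {i j : Fin (c.lastDigit + 1)} {x : OnePoint c.K}
    (hi : OnePoint.map c.σ x ∈ interval c.σ (c.A i))
    (hj : OnePoint.map c.σ x ∈ interval c.σ (c.A j)) : (c.A i)⁻¹ • x = (c.A j)⁻¹ • x := by
  rcases lt_trichotomy i j with h | rfl | h
  · exact c.inv_smul_eq_of_lt h hi hj
  · rfl
  · exact (c.inv_smul_eq_of_lt h hj hi).symm

/-- This frees the rest of the argument from the choice of the smallest index. -/
theorem T_eq {i : Fin (c.lastDigit + 1)} {x : OnePoint c.K}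
    (hi : OnePoint.map c.σ x ∈ interval c.σ (c.A i)) : c.T x = (c.A i)⁻¹ • x := by
  classical
  unfold T gaussMap
  have h : ∃ a, OnePoint.map c.σ x ∈ interval c.σ (c.A a) := ⟨i, hi⟩
  rw [dif_pos h]
  exact c.inv_smul_eq_inv_smul (Fin.find_spec h) hi

theorem exists_nonneg_pair {x : OnePoint c.K} (hx : OnePoint.map c.σ x ∈ baseInterval) :
    ∃ p q : c.K, (p ≠ 0 ∨ q ≠ 0) ∧ x = ofPair p q ∧ 0 ≤ c.σ p ∧ 0 ≤ c.σ q := by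
  cases x with
  | infty => exact ⟨1, 0, by simp, ofPair_one_zero.symm, by simp, by simp⟩
  | coe k =>
    rw [OnePoint.map_some, coe_mem_baseInterval] at hx
    exact ⟨k, 1, by simp, (ofPair_one k).symm, hx, by simp⟩

/-- The point belongs to the first interval whose right endpoint is not to its left. -/
theorem exists_mem_interval {x : OnePoint c.K} (hx : OnePoint.map c.σ x ∈ baseInterval) :
    ∃ i, OnePoint.map c.σ x ∈ interval c.σ (c.A i) := by
  obtain ⟨p, q, hpq, rfl, hp, hq⟩ := c.exists_nonneg_pair hx
  set u : ℕ → ℝ := fun i => (c.nmats i).d.val * c.σ p - (c.nmats i).b.val * c.σ q with hu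
  set v : ℕ → ℝ := fun i => (c.nmats i).a.val * c.σ q - (c.nmats i).c.val * c.σ p with hv
  have hlast : 0 ≤ v c.lastDigit := by
    obtain ⟨h1, h2, h3, h4⟩ := c.nmats_last
    simp [hv, h1, h3, embed_one, hq, c.val_eq_zero.2 rfl]
  have hlast_det : (c.nmats c.lastDigit).det = 1 := by
    obtain ⟨h1, h2, h3, h4⟩ := c.nmats_last
    simp [Mat.det, h1, h3, h4]
  have hne : ¬ (1 : ZW c.ca c.cb) = -1 := by
    intro h
    have := congrArg ZW.val h
    rw [ZW.val_neg, embed_one] at this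
    norm_num at this
  -- `R i` says that `x` is at most the right endpoint of `I_i`.
  let R : ℕ → Prop := fun i => ((c.nmats i).det = 1 → 0 ≤ v i) ∧ ((c.nmats i).det = -1 → u i ≤ 0)
  have hR : ∃ i, R i := ⟨c.lastDigit, fun _ => hlast, fun h => absurd (hlast_det.symm.trans h) hne⟩
  classical
  set i := Nat.find hR with hi
  have hi_le : i ≤ c.lastDigit :=
    Nat.find_min' hR ⟨fun _ => hlast, fun h => absurd (hlast_det.symm.trans h) hne⟩
  have hRi : R i := Nat.find_spec hR
  -- By minimality `x` is to the right of the left endpoint of `I_i`, which is the right endpoint of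
  -- the preceding interval; for `i = 0` the left endpoint is `0`.
  have hLi : ((c.nmats i).det = 1 → 0 ≤ u i) ∧ ((c.nmats i).det = -1 → v i ≤ 0) := by
    rcases Nat.eq_zero_or_eq_succ_pred i with h0 | hs
    · rw [h0]
      rcases c.nmats_zero with ⟨h1, h2, h3, h4⟩ | ⟨h1, h2⟩
      · have hd : (c.nmats 0).det = 1 := by simp [Mat.det, h1, h2, h4]
        refine ⟨fun _ => ?_, fun h => absurd (hd.symm.trans h) hne⟩
        simp [hu, h2, h4, embed_one, hp, c.val_eq_zero.2 rfl]
      · refine ⟨fun h => absurd (h.symm.trans h2) hne, fun _ => ?_⟩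
        simp only [hv, h1, c.val_eq_zero.2 rfl, zero_mul, zero_sub]
        have := mul_nonneg (c.nmats_nonneg (Nat.zero_le _)).2.2.1 hp
        linarith
    · have hnR : ¬ R i.pred := Nat.find_min hR (by rw [← hi]; omega)
      have hch := c.chain (i := i.pred) (by omega)
      rw [show i.pred + 1 = i by omega] at hch
      rcases hch with ⟨h1, h2, h3, h4⟩ | ⟨h1, h2, h3, h4⟩
      · refine ⟨fun h => absurd (h.symm.trans h2) hne, fun _ => ?_⟩
        have : ¬ 0 ≤ v i.pred := fun h => hnR ⟨fun _ => h, fun h' => absurd (h1.symm.trans h') hne⟩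
        simp only [hv, h3, h4] at this ⊢
        linarith
      · refine ⟨fun _ => ?_, fun h => absurd (h2.symm.trans h) hne⟩
        have : ¬ u i.pred ≤ 0 := fun h => hnR ⟨fun h' => absurd (h'.symm.trans h1) hne, fun _ => h⟩
        simp only [hu, h3, h4] at this ⊢
        linarith
  refine ⟨⟨i, by omega⟩, ?_⟩
  rw [c.mem_interval_ofPair _ hpq]
  change 0 ≤ u i * v i
  rcases c.nmats_det hi_le with h | h
  · exact mul_nonneg (hLi.1 h) (hRi.1 h)
  · exact mul_nonneg_of_nonpos_of_nonpos (hRi.2 h) (hLi.2 h)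

end Case

/-! ### Cones of matrices and parabolic runs -/

namespace Mat

variable {a b : ℤ}

/-- The sum of two matrices. -/
def add {R : Type} [CommRing R] (A B : Mat R) : Mat R :=
  ⟨A.a + B.a, A.b + B.b, A.c + B.c, A.d + B.d⟩

/-- The matrices `G + G₁ + ⋯ + Gₘ` with the `Gᵢ` taken from a list. -/
inductive InCone {R : Type} [CommRing R] (G : Mat R) (Gs : List (Mat R)) : Mat R → Prop
  /-- The apex. -/
  | apex : InCone G Gs G
  /-- Addition of a generator. -/
  | add (M G' : Mat R) : InCone G Gs M → G' ∈ Gs → InCone G Gs (M.add G')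

section Cone

variable {R : Type} [CommRing R]

theorem add_mul (A B C : Mat R) : (A.add B).mul C = (A.mul C).add (B.mul C) := by
  ext <;> simp [add, mul] <;> ring

theorem add_assoc' (A B C : Mat R) : (A.add B).add C = A.add (B.add C) := by
  ext <;> simp [add] <;> ring

theorem mul_assoc' (A B C : Mat R) : (A.mul B).mul C = A.mul (B.mul C) := by
  ext <;> simp [mul] <;> ring

theorem InCone.mono {G M : Mat R} {Gs Gs' : List (Mat R)} (h : InCone G Gs M) (hs : Gs ⊆ Gs') :
    InCone G Gs' M := by
  induction h with
  | apex => exact .apex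
  | add M G' _ hG ih => exact .add _ _ ih (hs hG)

theorem InCone.mul {G M : Mat R} {Gs : List (Mat R)} (h : InCone G Gs M) (B : Mat R) :
    InCone (G.mul B) (Gs.map fun G' => G'.mul B) (M.mul B) := by
  induction h with
  | apex => exact .apex
  | add M G' _ hG ih =>
    rw [add_mul]
    exact .add _ _ ih (List.mem_map_of_mem hG)

theorem InCone.add_mul_of_mem {G M G₁ M₁ B : Mat R} {Gs Gs₁ : List (Mat R)} (h : InCone G Gs M)
    (h₁ : InCone G₁ Gs₁ M₁) (hs : ∀ G' ∈ G :: Gs, G'.mul B ∈ Gs₁) :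
    InCone G₁ Gs₁ (M₁.add (M.mul B)) := by
  induction h with
  | apex => exact .add _ _ h₁ (hs _ (by simp))
  | add M G' _ hG ih =>
    rw [add_mul, ← add_assoc']
    exact .add _ _ ih (hs _ (by simp [hG]))

theorem pow_mul_subOne {B : Mat R} (hB : B.mul B.subOne = B.subOne) (k : ℕ) :
    (B.pow k).mul B.subOne = B.subOne := by
  induction k with
  | zero => ext <;> simp [pow, one, Mat.mul]
  | succ k ih => rw [pow, mul_assoc', hB, ih]

theorem mul_eq_add_mul_subOne (A B : Mat R) : A.mul B = A.add (A.mul B.subOne) := by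
  ext <;> simp [add, Mat.mul, subOne] <;> ring

/-- The hypothesis says that `N = B - 1` has square zero, whence `M B^(k+1) = M B + k M N`. Writing
`M` as apex plus generators, both terms expand over the listed matrices. -/
theorem InCone.mul_pow {G M B : Mat R} {Gs : List (Mat R)} (h : InCone G Gs M)
    (hB : B.mul B.subOne = B.subOne) (k : ℕ) :
    InCone (G.mul B)
      (Gs.map (fun G' => G'.mul B) ++ (G :: Gs).map (fun G' => G'.mul B.subOne))
      (M.mul (B.pow (k + 1))) := by
  induction k with
  | zero =>
    have : B.pow (0 + 1) = B := by ext <;> simp [pow, one, Mat.mul]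
    rw [this]
    exact (h.mul B).mono (List.subset_append_left _ _)
  | succ k ih =>
    rw [pow, ← mul_assoc', mul_eq_add_mul_subOne (M.mul (B.pow (k + 1))), mul_assoc',
      pow_mul_subOne hB]
    exact h.add_mul_of_mem ih fun G' hG' =>
      List.mem_append_right _ (List.mem_map_of_mem (f := fun G' => G'.mul B.subOne) hG')

end Cone

/-- The real value of the threshold. -/
noncomputable def tval (M : Mat (ZW a b)) : ℝ :=
  max (|M.a.conj.val| + |M.c.conj.val|) (|M.b.conj.val| + |M.d.conj.val|)

/-- The entries are nonnegative real numbers. -/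
def Nonneg (M : Mat (ZW a b)) : Prop := 0 ≤ M.a.val ∧ 0 ≤ M.b.val ∧ 0 ≤ M.c.val ∧ 0 ≤ M.d.val

end Mat

/-! ### From the checks to decreasing blocks -/

namespace Case

variable (c : Case)

theorem thr_val (M : Mat (ZW c.ca c.cb)) : M.thr.val = M.tval := by
  simp only [Mat.thr, val_max, val_add, ZW.val_abs c.disc_nonneg, Mat.tval]

theorem val_zero : ZW.val (0 : ZW c.ca c.cb) = 0 := c.val_eq_zero.2 rfl

theorem val_conj_add (z w : ZW c.ca c.cb) : (z + w).conj.val = z.conj.val + w.conj.val := by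
  simp only [← embedConj_phi, map_add]

theorem tval_add_le (M N : Mat (ZW c.ca c.cb)) : (M.add N).tval ≤ M.tval + N.tval := by
  simp only [Mat.tval, Mat.add, val_conj_add]
  apply max_le
  · linarith [abs_add_le M.a.conj.val N.a.conj.val, abs_add_le M.c.conj.val N.c.conj.val,
      le_max_left (|M.a.conj.val| + |M.c.conj.val|) (|M.b.conj.val| + |M.d.conj.val|),
      le_max_left (|N.a.conj.val| + |N.c.conj.val|) (|N.b.conj.val| + |N.d.conj.val|)]
  · linarith [abs_add_le M.b.conj.val N.b.conj.val, abs_add_le M.d.conj.val N.d.conj.val,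
      le_max_right (|M.a.conj.val| + |M.c.conj.val|) (|M.b.conj.val| + |M.d.conj.val|),
      le_max_right (|N.a.conj.val| + |N.c.conj.val|) (|N.b.conj.val| + |N.d.conj.val|)]

theorem nonneg_mul {M N : Mat (ZW c.ca c.cb)} (hM : M.Nonneg) (hN : N.Nonneg) :
    (M.mul N).Nonneg := by
  obtain ⟨h1, h2, h3, h4⟩ := hM
  obtain ⟨h5, h6, h7, h8⟩ := hN
  simp only [Mat.Nonneg, Mat.mul, val_add, val_mul]
  exact ⟨by positivity, by positivity, by positivity, by positivity⟩

/-- The row of the product is additive in `M` and the threshold is subadditive, so weak inequalities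
for the generators preserve the inequalities of the apex, including the strict one. -/
theorem rowCheck_spec {G B : Mat (ZW c.ca c.cb)} {Gs : List (Mat (ZW c.ca c.cb))} {κ ρ : Bool}
    (h : G.rowCheck Gs B κ ρ = true) (hB : B.Nonneg) {M : Mat (ZW c.ca c.cb)}
    (hM : Mat.InCone G Gs M) :
    M.tval * (B.row κ).1.val ≤ ((M.mul B).row ρ).1.val ∧
    M.tval * (B.row κ).2.val ≤ ((M.mul B).row ρ).2.val ∧
    (M.tval * (B.row κ).1.val < ((M.mul B).row ρ).1.val ∨
      M.tval * (B.row κ).2.val < ((M.mul B).row ρ).2.val) := by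
  have hB1 : 0 ≤ (B.row κ).1.val := by
    cases κ <;> simp [Mat.row, hB.1, hB.2.2.1]
  have hB2 : 0 ≤ (B.row κ).2.val := by
    cases κ <;> simp [Mat.row, hB.2.1, hB.2.2.2]
  simp only [Mat.rowCheck, Mat.rowGt, Mat.rowGe, Bool.and_eq_true, Bool.or_eq_true,
    List.all_eq_true, ZW.nonneg_iff c.disc_nonneg, ZW.pos_iff c.disc_nonneg, val_sub, val_mul,
    thr_val, sub_nonneg, sub_pos] at h
  obtain ⟨⟨⟨h1, h2⟩, h3⟩, h4⟩ := h
  induction hM with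
  | apex => exact ⟨h1, h2, h3⟩
  | add M G' _ hG ih =>
    obtain ⟨i1, i2, i3⟩ := ih
    obtain ⟨g1, g2⟩ := h4 G' hG
    have ht := c.tval_add_le M G'
    have r1 : (((M.add G').mul B).row ρ).1.val =
        ((M.mul B).row ρ).1.val + ((G'.mul B).row ρ).1.val := by
      rw [Mat.add_mul]
      cases ρ <;> simp [Mat.row, Mat.add, val_add]
    have r2 : (((M.add G').mul B).row ρ).2.val =
        ((M.mul B).row ρ).2.val + ((G'.mul B).row ρ).2.val := by
      rw [Mat.add_mul]
      cases ρ <;> simp [Mat.row, Mat.add, val_add]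
    rw [r1, r2]
    have s1 := mul_le_mul_of_nonneg_right ht hB1
    have s2 := mul_le_mul_of_nonneg_right ht hB2
    refine ⟨by linarith, by linarith, ?_⟩
    rcases i3 with i3 | i3
    · left; linarith
    · right; linarith

/-- The possible shapes of the matrix of a word. -/
def Shape (M : Mat (ZW c.ca c.cb)) : Prop :=
  (0 < M.a.val ∧ 0 < M.b.val ∧ 0 < M.c.val ∧ 0 < M.d.val) ∨
  (M.a = 0 ∧ M.b = 1 ∧ M.c = 1 ∧ 1 < M.d.val) ∨
  (M.a = 1 ∧ M.b = 0 ∧ 1 < M.c.val ∧ M.d = 1)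

/-- Positivity survives adding nonnegative generators. In the other two shapes the generators vanish
outside the one entry that is only bounded below. -/
theorem shapeCheck_spec {G : Mat (ZW c.ca c.cb)} {Gs : List (Mat (ZW c.ca c.cb))}
    (h : G.shapeCheck Gs = true) (hG : ∀ G' ∈ Gs, G'.Nonneg) {M : Mat (ZW c.ca c.cb)}
    (hM : Mat.InCone G Gs M) : c.Shape M := by
  simp only [Mat.shapeCheck, Mat.pos, Bool.or_eq_true, Bool.and_eq_true, beq_iff_eq,
    List.all_eq_true, ZW.pos_iff c.disc_nonneg, val_sub, embed_one, sub_pos] at h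
  rcases h with (⟨⟨⟨h1, h2⟩, h3⟩, h4⟩ | ⟨⟨⟨⟨h1, h2⟩, h3⟩, h4⟩, h5⟩) | ⟨⟨⟨⟨h1, h2⟩, h3⟩, h4⟩, h5⟩
  · left
    induction hM with
    | apex => exact ⟨h1, h2, h3, h4⟩
    | add M G' _ hG' ih =>
      obtain ⟨i1, i2, i3, i4⟩ := ih
      obtain ⟨g1, g2, g3, g4⟩ := hG G' hG'
      simp only [Mat.add, val_add]
      exact ⟨by positivity, by positivity, by positivity, by positivity⟩
  · right; left
    induction hM with
    | apex => exact ⟨h1, h2, h3, h4⟩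
    | add M G' _ hG' ih =>
      obtain ⟨i1, i2, i3, i4⟩ := ih
      obtain ⟨g1, g2, g3, g4⟩ := hG G' hG'
      obtain ⟨⟨e1, e2⟩, e3⟩ := h5 G' hG'
      simp only [Mat.add, val_add, i1, i2, i3, e1, e2, e3, add_zero, true_and]
      linarith
  · right; right
    induction hM with
    | apex => exact ⟨h1, h2, h3, h4⟩
    | add M G' _ hG' ih =>
      obtain ⟨i1, i2, i3, i4⟩ := ih
      obtain ⟨g1, g2, g3, g4⟩ := hG G' hG'
      obtain ⟨⟨e1, e2⟩, e3⟩ := h5 G' hG'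
      simp only [Mat.add, val_add, i1, i2, i4, e1, e2, e3, add_zero, true_and, and_true]
      linarith

/-- The matrix `P` is the image of `M`, up to sign. -/
def Represents (P : GL (Fin 2) c.K) (M : Mat (ZW c.ca c.cb)) : Prop :=
  (M.map c.phi).EqSign P.val

variable {c} {P : GL (Fin 2) c.K} {M : Mat (ZW c.ca c.cb)}

theorem represents_A (i : Fin (c.lastDigit + 1)) : c.Represents (c.A i) (c.nmats i) :=
  c.matrices_eqSign i

theorem Represents.mul {Q : GL (Fin 2) c.K} {N : Mat (ZW c.ca c.cb)} (h : c.Represents P M)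
    (h' : c.Represents Q N) : c.Represents (P * Q) (M.mul N) := by
  rcases h with h | h <;> rcases h' with h' | h' <;>
    simp [Represents, Mat.EqSign, h, h']

theorem Represents.one : c.Represents 1 Mat.one := by
  simp [Represents, Mat.EqSign]

theorem Represents.entries (h : c.Represents P M) :
    (P 0 0 = c.phi M.a ∧ P 0 1 = c.phi M.b ∧ P 1 0 = c.phi M.c ∧ P 1 1 = c.phi M.d) ∨
    (P 0 0 = -c.phi M.a ∧ P 0 1 = -c.phi M.b ∧ P 1 0 = -c.phi M.c ∧ P 1 1 = -c.phi M.d) := by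
  rcases h with h | h <;> simp [h, Mat.toMatrix, Mat.map]

theorem Represents.growth_coe (h : c.Represents P M) (y : ℝ) :
    growth c.σ P (y : OnePoint ℝ) =
      max |M.a.val * y + M.b.val| |M.c.val * y + M.d.val| / max y 1 := by
  rcases h.entries with ⟨h1, h2, h3, h4⟩ | ⟨h1, h2, h3, h4⟩
  · simp only [growth, OnePoint.elim_some, h1, h2, h3, h4, embed_phi]
  · simp only [growth, OnePoint.elim_some, h1, h2, h3, h4, embed_phi, map_neg]
    rw [← abs_neg (M.a.val * y + M.b.val), ← abs_neg (M.c.val * y + M.d.val)]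
    ring_nf

theorem Represents.growth_infty (h : c.Represents P M) :
    growth c.σ P ∞ = max |M.a.val| |M.c.val| := by
  rcases h.entries with ⟨h1, h2, h3, h4⟩ | ⟨h1, h2, h3, h4⟩ <;>
    simp only [growth, OnePoint.elim_infty, h1, h3, embed_phi, map_neg, abs_neg]

theorem Represents.threshold_eq (h : c.Represents P M) : threshold c.σ' P = M.tval := by
  rcases h.entries with ⟨h1, h2, h3, h4⟩ | ⟨h1, h2, h3, h4⟩ <;>
    simp only [threshold, Mat.tval, h1, h2, h3, h4, embedConj_phi, map_neg, abs_neg]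

theorem Represents.conj_row (h : c.Represents P M) (x : ℝ) :
    |c.σ' (P 0 0) * x + c.σ' (P 0 1)| = |M.a.conj.val * x + M.b.conj.val| ∧
    |c.σ' (P 1 0) * x + c.σ' (P 1 1)| = |M.c.conj.val * x + M.d.conj.val| := by
  rcases h.entries with ⟨h1, h2, h3, h4⟩ | ⟨h1, h2, h3, h4⟩
  · simp only [h1, h2, h3, h4, embedConj_phi, and_self]
  · simp only [h1, h2, h3, h4, embedConj_phi, map_neg]
    rw [← abs_neg (M.a.conj.val * x + M.b.conj.val), ← abs_neg (M.c.conj.val * x + M.d.conj.val)]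
    constructor <;> ring_nf

theorem nmats_Nonneg {i : ℕ} (hi : i ≤ c.lastDigit) : (c.nmats i).Nonneg := c.nmats_nonneg hi

/-- The point with parameter `y` of the interval of a digit. -/
noncomputable def param (c : Case) (i : ℕ) (y : ℝ) : ℝ :=
  ((c.nmats i).a.val * y + (c.nmats i).b.val) / ((c.nmats i).c.val * y + (c.nmats i).d.val)

/-- On `I_i` the function `x ∨ 1` is given by the dominating row of `A_i`. In the parameter `y`,
both sides of `f > t` become linear forms over the same denominator, so coefficientwise
inequalities, one of them strict, suffice for `y > 0`. -/
theorem param_mem_sharpSet {i : ℕ} (hi : i < c.lastDigit) {ρ : Bool} (hP : c.Represents P M)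
    (hM : M.Nonneg)
    (h₁ : M.tval * ((c.nmats i).row (c.dom i)).1.val ≤ ((M.mul (c.nmats i)).row ρ).1.val)
    (h₂ : M.tval * ((c.nmats i).row (c.dom i)).2.val ≤ ((M.mul (c.nmats i)).row ρ).2.val)
    (h₃ : M.tval * ((c.nmats i).row (c.dom i)).1.val < ((M.mul (c.nmats i)).row ρ).1.val ∨
      M.tval * ((c.nmats i).row (c.dom i)).2.val < ((M.mul (c.nmats i)).row ρ).2.val)
    {y : ℝ} (hy : 0 < y) : (c.param i y : OnePoint ℝ) ∈ sharpSet c.σ c.σ' P := by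
  obtain ⟨n1, n2, n3, n4⟩ := c.nmats_nonneg hi.le
  obtain ⟨p3, p4⟩ := c.nmats_pos hi
  have hdom := c.nmats_dominates hi
  simp only [Mat.dominates, Bool.and_eq_true, ZW.nonneg_iff c.disc_nonneg, val_sub,
    sub_nonneg] at hdom
  obtain ⟨m1, m2, m3, m4⟩ := hM
  have hden : 0 < (c.nmats i).c.val * y + (c.nmats i).d.val := by positivity
  have hnum : 0 ≤ (c.nmats i).a.val * y + (c.nmats i).b.val := by positivity
  refine ⟨coe_mem_baseInterval.2 (div_nonneg hnum hden.le), ?_⟩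
  rw [hP.threshold_eq, hP.growth_coe, lt_div_iff₀ (by positivity)]
  have hmax : max (c.param i y) 1 = (((c.nmats i).row (c.dom i)).1.val * y +
      ((c.nmats i).row (c.dom i)).2.val) / ((c.nmats i).c.val * y + (c.nmats i).d.val) := by
    cases hk : c.dom i <;> simp only [hk, Mat.row, Bool.not_false, Bool.not_true, if_true,
      Bool.false_eq_true, if_false] at hdom ⊢
    · apply max_eq_left
      rw [param, one_le_div hden]
      nlinarith
    · rw [div_self hden.ne']
      apply max_eq_right
      rw [param, div_le_one hden]
      nlinarith
  have hlt : M.tval * max (c.param i y) 1 < (((M.mul (c.nmats i)).row ρ).1.val * y +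
      ((M.mul (c.nmats i)).row ρ).2.val) / ((c.nmats i).c.val * y + (c.nmats i).d.val) := by
    rw [hmax, ← mul_div_assoc, div_lt_div_iff_of_pos_right hden]
    have := mul_le_mul_of_nonneg_right h₁ hy.le
    rcases h₃ with h₃ | h₃
    · have := mul_lt_mul_of_pos_right h₃ hy
      linarith
    · linarith
  refine hlt.trans_le ?_
  cases ρ
  · refine le_trans (le_of_eq ?_) ((le_abs_self _).trans (le_max_left _ _))
    simp only [Mat.row, Mat.mul, val_add, val_mul, param, Bool.false_eq_true, if_false]
    field_simp
    ring
  · refine le_trans (le_of_eq ?_) ((le_abs_self _).trans (le_max_right _ _))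
    simp only [Mat.row, Mat.mul, val_add, val_mul, param, if_true]
    field_simp
    ring

theorem map_smul_coe {i : Fin (c.lastDigit + 1)} (hi : i.val < c.lastDigit) {y : ℝ} (hy : 0 ≤ y) :
    (c.A i).map c.σ • (y : OnePoint ℝ) = (c.param i y : OnePoint ℝ) := by
  obtain ⟨n1, n2, n3, n4⟩ := c.nmats_nonneg hi.le
  obtain ⟨p3, p4⟩ := c.nmats_pos hi
  have hden : 0 < (c.nmats i).c.val * y + (c.nmats i).d.val := by positivity
  rw [OnePoint.smul_some_eq_ite]
  rcases (represents_A i).entries with ⟨h1, h2, h3, h4⟩ | ⟨h1, h2, h3, h4⟩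
  · simp only [GeneralLinearGroup.map_apply, h1, h2, h3, h4, embed_phi, hden.ne', if_false, param]
  · simp only [GeneralLinearGroup.map_apply, h1, h2, h3, h4, embed_phi, map_neg]
    have e : -(c.nmats i).c.val * y + -(c.nmats i).d.val =
      -((c.nmats i).c.val * y + (c.nmats i).d.val) := by ring
    have e' : -(c.nmats i).a.val * y + -(c.nmats i).b.val =
      -((c.nmats i).a.val * y + (c.nmats i).b.val) := by ring
    rw [e, e', if_neg (neg_ne_zero.2 hden.ne'), neg_div_neg_eq, param]

theorem map_smul_infty {i : Fin (c.lastDigit + 1)} (hi : i.val < c.lastDigit) :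
    (c.A i).map c.σ • (∞ : OnePoint ℝ) =
      (((c.nmats i).a.val / (c.nmats i).c.val : ℝ) : OnePoint ℝ) := by
  obtain ⟨p3, p4⟩ := c.nmats_pos hi
  rw [OnePoint.smul_infty_eq_ite]
  rcases (represents_A i).entries with ⟨h1, h2, h3, h4⟩ | ⟨h1, h2, h3, h4⟩
  · simp only [GeneralLinearGroup.map_apply, h1, h3, embed_phi, p3.ne', if_false]
  · simp only [GeneralLinearGroup.map_apply, h1, h3, embed_phi, map_neg, neg_eq_zero, p3.ne',
      if_false, neg_div_neg_eq]

theorem tendsto_param {i : ℕ} (hi : i < c.lastDigit) :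
    Tendsto (c.param i) atTop (nhds ((c.nmats i).a.val / (c.nmats i).c.val)) := by
  obtain ⟨p3, p4⟩ := c.nmats_pos hi
  have h0 : Tendsto (fun y : ℝ => y⁻¹) atTop (nhds 0) := tendsto_inv_atTop_zero
  have h1 := ((h0.const_mul (c.nmats i).b.val).const_add (c.nmats i).a.val).div
    ((h0.const_mul (c.nmats i).d.val).const_add (c.nmats i).c.val) (by simpa using p3.ne')
  simp only [mul_zero, add_zero] at h1
  refine h1.congr' ?_
  filter_upwards [eventually_gt_atTop 0] with y hy
  simp only [param, Pi.div_apply]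
  rw [← mul_div_mul_right _ _ hy.ne']
  congr 1 <;> field_simp

/-- The endpoints need not lie in `S`; they are limits for `y → 0` from the right and for `y → ∞`.
-/
theorem interval_subset_closure {i : Fin (c.lastDigit + 1)} (hi : i.val < c.lastDigit)
    {S : Set (OnePoint ℝ)} (hS : ∀ y : ℝ, 0 < y → (c.param i y : OnePoint ℝ) ∈ S) :
    interval c.σ (c.A i) ⊆ closure S := by
  obtain ⟨n1, n2, n3, n4⟩ := c.nmats_nonneg hi.le
  obtain ⟨p3, p4⟩ := c.nmats_pos hi
  rintro _ ⟨x, hx, rfl⟩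
  rcases hx with rfl | ⟨y, hy, rfl⟩
  · simp only [map_smul_infty hi]
    exact mem_closure_of_tendsto ((OnePoint.continuous_coe.tendsto _).comp (tendsto_param hi))
      ((eventually_gt_atTop 0).mono hS)
  · simp only [map_smul_coe hi hy]
    have hc : ContinuousAt (c.param i) y := by
      unfold param
      exact ContinuousAt.div (by fun_prop) (by fun_prop) (by positivity)
    exact mem_closure_of_tendsto ((OnePoint.continuous_coe.tendsto _).comp
      (hc.tendsto.mono_left nhdsWithin_le_nhds : Tendsto _ (nhdsWithin y (Set.Ioi y)) _))
      (eventually_mem_nhdsWithin.mono fun z hz => hS z (hy.trans_lt hz))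

/-- From `|x| ≤ |x + s| + |s|` one gets the weak inequality, and since `s ≠ 0` equality is possible
only for `|x + s| = 1`. -/
theorem strict_of_shape_left {s x : ℝ} (hs : s ≠ 0) (h₁ : x + s ≠ 1) (h₂ : x + s ≠ -1) :
    max |x| 1 < max (|0| + |1|) (|1| + |s|) * max |0 * x + 1| |1 * x + s| := by
  have hs' : 0 < |s| := abs_pos.2 hs
  have hne : |x + s| ≠ 1 := by
    intro h
    rcases eq_or_eq_neg_of_abs_eq h with h | h <;> contradiction
  have htri : |x| ≤ |x + s| + |s| := by
    have := abs_sub (x + s) s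
    rwa [add_sub_cancel_right] at this
  simp only [zero_mul, zero_add, abs_one, one_mul, abs_zero]
  rw [max_eq_right (by linarith : (1 : ℝ) ≤ 1 + |s|)]
  rcases le_total |x + s| 1 with h | h
  · rw [max_eq_left h, mul_one]
    have := lt_of_le_of_ne h hne
    exact max_lt (by linarith) (by linarith)
  · rw [max_eq_right h]
    have := lt_of_le_of_ne h hne.symm
    exact max_lt (by nlinarith) (by nlinarith)

/-- This is the previous estimate with the homogeneous coordinates exchanged; the critical case is
`|s x + 1| = |x|`. -/
theorem strict_of_shape_right {s x : ℝ} (hs : s ≠ 0) (h₁ : s * x + 1 ≠ x) (h₂ : s * x + 1 ≠ -x) :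
    max |x| 1 < max (|1| + |s|) (|0| + |1|) * max |1 * x + 0| |s * x + 1| := by
  have hs' : 0 < |s| := abs_pos.2 hs
  have hne : |s * x + 1| ≠ |x| := by
    intro h
    rcases abs_eq_abs.1 h with h | h <;> contradiction
  have htri : 1 ≤ |s * x + 1| + |s| * |x| := by
    have := abs_sub (s * x + 1) (s * x)
    rwa [add_sub_cancel_left, abs_one, abs_mul s x] at this
  have hx := abs_nonneg x
  simp only [add_zero, zero_add, abs_one, one_mul, abs_zero]
  rw [max_eq_left (by linarith : (1 : ℝ) ≤ 1 + |s|)]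
  rcases le_total |x| |s * x + 1| with h | h
  · rw [max_eq_right h]
    have := lt_of_le_of_ne h hne.symm
    exact max_lt (by nlinarith) (by nlinarith)
  · rw [max_eq_left h]
    have := lt_of_le_of_ne h hne
    exact max_lt (by nlinarith [abs_nonneg (s * x + 1)]) (by nlinarith)

/-- The critical cases `β' + s' = ±1` and `s' β' + 1 = ±β'` are conjugates of equations in the
field. In the given embedding these are impossible, as `β ≥ 0` and `s > 1`. So condition (iii) needs
no knowledge of the boundary of `E♯` beyond `β ≥ 0`. -/
theorem strict_of_zero_entry (hP : c.Represents P M) (hM : c.Shape M)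
    (hz : ∃ i j, P i j = 0) {β : c.K} (hβ : 0 ≤ c.σ β) :
    max |c.σ' β| 1 < threshold c.σ' P *
      max |c.σ' (P 0 0) * c.σ' β + c.σ' (P 0 1)| |c.σ' (P 1 0) * c.σ' β + c.σ' (P 1 1)| := by
  rw [(hP.conj_row _).1, (hP.conj_row _).2, hP.threshold_eq, Mat.tval]
  have c0 : ZW.val (ZW.conj (0 : ZW c.ca c.cb)) = 0 := by rw [← embedConj_phi]; simp
  have c1 : ZW.val (ZW.conj (1 : ZW c.ca c.cb)) = 1 := by rw [← embedConj_phi]; simp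
  have cne : ∀ z : ZW c.ca c.cb, 1 < z.val → z.conj.val ≠ 0 := by
    intro z hz h
    rw [← embedConj_phi, map_eq_zero] at h
    have := c.embed_phi z
    rw [h, map_zero] at this
    linarith
  rcases hM with ⟨h1, h2, h3, h4⟩ | ⟨h1, h2, h3, h4⟩ | ⟨h1, h2, h3, h4⟩
  · exfalso
    rw [← embed_phi] at h1 h2 h3 h4
    have n0 : ∀ z : c.K, 0 < c.σ z → z ≠ 0 := by
      rintro z hz rfl
      simp at hz
    obtain ⟨i, j, hij⟩ := hz
    rcases hP.entries with ⟨e1, e2, e3, e4⟩ | ⟨e1, e2, e3, e4⟩ <;>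
      fin_cases i <;> fin_cases j <;>
      simp [e1, e2, e3, e4, n0 _ h1, n0 _ h2, n0 _ h3, n0 _ h4] at hij
  · rw [h1, h2, h3, c0, c1]
    have key : ∀ t : c.K, c.σ' β + M.d.conj.val = c.σ' t → c.σ β + M.d.val = c.σ t := by
      intro t ht
      rw [← embedConj_phi, ← map_add] at ht
      rw [← embed_phi, ← map_add, c.σ'.injective ht]
    refine strict_of_shape_left (cne _ h4) (fun h => ?_) (fun h => ?_)
    · have := key 1 (by rw [h, map_one])
      rw [map_one] at this
      linarith
    · have := key (-1) (by rw [h, map_neg, map_one])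
      rw [map_neg, map_one] at this
      linarith
  · rw [h1, h2, h4, c0, c1]
    have key : ∀ t : c.K, M.c.conj.val * c.σ' β + 1 = c.σ' t → M.c.val * c.σ β + 1 = c.σ t := by
      intro t ht
      rw [← embedConj_phi, ← map_mul, ← map_one c.σ', ← map_add] at ht
      rw [← embed_phi, ← map_mul, ← c.σ'.injective ht, map_add, map_one]
    refine strict_of_shape_right (cne _ h3) (fun h => ?_) (fun h => ?_)
    · have := key β h
      nlinarith
    · have := key (-β) (by rw [h, map_neg])
      rw [map_neg] at this
      nlinarith

theorem isDecreasingBlock_of_check {G : Mat (ZW c.ca c.cb)} {Gs : List (Mat (ZW c.ca c.cb))}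
    {b₀ bu : Fin (c.lastDigit + 1)} {v : List (Fin (c.lastDigit + 1))}
    (h₀ : b₀ ≠ Fin.last c.lastDigit) (hu : bu ≠ Fin.last c.lastDigit)
    (hP : c.Represents ((b₀ :: v).map c.A).prod M) (hM : M.Nonneg) (hGs : ∀ G' ∈ Gs, G'.Nonneg)
    (hc : Mat.InCone G Gs M) (hs : G.shapeCheck Gs = true)
    (hb : G.blockCheck Gs (c.nmats bu) (c.dom bu) = true) :
    IsDecreasingBlock c.σ c.σ' c.A (b₀ :: (v ++ [bu])) := by
  have hbu : bu.val < c.lastDigit := Fin.val_lt_last hu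
  refine ⟨b₀, v, bu, _, rfl, rfl, h₀, hu, ?_, ?_⟩
  · obtain ⟨ρ, hρ⟩ : ∃ ρ, G.rowCheck Gs (c.nmats bu) (c.dom bu) ρ = true := by
      rw [Mat.blockCheck, Bool.or_eq_true] at hb
      exact hb.elim (fun h => ⟨_, h⟩) (fun h => ⟨_, h⟩)
    obtain ⟨h1, h2, h3⟩ := c.rowCheck_spec hρ (nmats_Nonneg hbu.le) hc
    exact interval_subset_closure hbu fun y hy => param_mem_sharpSet hbu hP hM h1 h2 h3 hy
  · intro hz β hβ
    refine strict_of_zero_entry hP (c.shapeCheck_spec hs hGs hc) hz ?_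
    rw [← coe_mem_baseInterval]
    exact closure_minimal (fun x hx => hx.1) isClosed_baseInterval
      (frontier_subset_closure hβ.1)

end Case

/-! ### Completeness by traversing the search tree -/

namespace Case

/-- Every branch meets a block within 14 levels, a level being a single digit or a whole parabolic
run. -/
theorem searchTree_eq_true (c : Case) : c.searchTree = true := by
  cases c <;> decide +kernel

end Case

theorem subword_succ {n : ℕ} (s : ℕ → Fin (n + 1)) (i m : ℕ) :
    subword s i (m + 1) = subword s i m ++ [s (i + m)] := by
  simp [subword, List.range_succ]

theorem subword_succ' {n : ℕ} (s : ℕ → Fin (n + 1)) (i m : ℕ) :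
    subword s i (m + 1) = s i :: subword s (i + 1) m := by
  simp only [subword, List.range_succ_eq_map, List.map_cons, List.map_map, add_zero]
  congr 1
  apply List.map_congr_left
  intro k _
  simp [Nat.succ_eq_add_one, add_assoc, add_comm 1 k]

namespace Case

variable {c : Case}

theorem one_ne_neg_one : (1 : ZW c.ca c.cb) ≠ -1 := by
  intro h
  have := congrArg ZW.val h
  rw [ZW.val_neg, embed_one] at this
  norm_num at this

theorem par_spec {i : ℕ} (h : c.par i = true) :
    i ≤ c.lastDigit ∧ (c.nmats i).subOne.Nonneg ∧
      (c.nmats i).mul (c.nmats i).subOne = (c.nmats i).subOne := by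
  have key : ∀ B : Mat (ZW c.ca c.cb), ((B.a = 1 ∧ 0 < B.b.val ∧ B.c = 0 ∧ B.d = 1) ∨
      (B.a = 1 ∧ B.b = 0 ∧ 0 < B.c.val ∧ B.d = 1)) →
      B.subOne.Nonneg ∧ B.mul B.subOne = B.subOne := by
    rintro ⟨x, y, z, w⟩ (⟨rfl, h, rfl, rfl⟩ | ⟨rfl, rfl, h, rfl⟩) <;> constructor <;>
      simp [Mat.subOne, Mat.mul, Mat.Nonneg, val_zero, h.le]
  simp only [par, Bool.or_eq_true, Bool.and_eq_true, beq_iff_eq] at h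
  rcases h with rfl | ⟨rfl, hd⟩
  · exact ⟨le_rfl, key _ (Or.inl c.nmats_last)⟩
  · refine ⟨Nat.zero_le _, key _ (Or.inr ?_)⟩
    rcases c.nmats_zero with h | h
    · exact h
    · exact absurd (hd.symm.trans h.2) one_ne_neg_one

theorem Represents.snoc {s : ℕ → Fin (c.lastDigit + 1)} {m : ℕ} {M : Mat (ZW c.ca c.cb)}
    (h : c.Represents ((subword s 0 m).map c.A).prod M) :
    c.Represents ((subword s 0 (m + 1)).map c.A).prod (M.mul (c.nmats (s m))) := by
  rw [subword_succ, List.map_append, List.prod_append]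
  simpa using h.mul (represents_A (s m))

theorem Represents.run {s : ℕ → Fin (c.lastDigit + 1)} {m : ℕ} {M : Mat (ZW c.ca c.cb)}
    (h : c.Represents ((subword s 0 m).map c.A).prod M) (k : ℕ)
    (hs : ∀ j < k, s (m + j) = s m) :
    c.Represents ((subword s 0 (m + k)).map c.A).prod (M.mul ((c.nmats (s m)).pow k)) := by
  induction k with
  | zero =>
    have : M.mul ((c.nmats (s m)).pow 0) = M := by ext <;> simp [Mat.pow, Mat.one, Mat.mul]
    rwa [this]
  | succ k ih =>
    have := (ih fun j hj => hs j (by omega)).snoc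
    rw [hs k (by omega), Mat.mul_assoc'] at this
    exact this

/-- This rules out a block at the root of the tree, where the word before the closing digit is
empty. -/
theorem not_shape_of_represents_one {M : Mat (ZW c.ca c.cb)} (h : c.Represents 1 M) :
    ¬ c.Shape M := by
  have n0 : ∀ z : ZW c.ca c.cb, 0 < z.val → c.phi z ≠ 0 := by
    intro z hz h0
    rw [← embed_phi, h0, map_zero] at hz
    exact lt_irrefl _ hz
  have e : M.b.val = 0 ∧ M.c.val = 0 ∧ M.a.val ≠ 0 := by
    simp only [← embed_phi]
    rcases h.entries with ⟨h1, h2, h3, h4⟩ | ⟨h1, h2, h3, h4⟩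
    · simp [← h1, ← h2, ← h3]
    · have h1' := neg_eq_iff_eq_neg.2 h1
      have h2' := neg_eq_iff_eq_neg.2 h2
      have h3' := neg_eq_iff_eq_neg.2 h3
      rw [← h1', ← h2', ← h3']
      simp
  rintro (⟨h1, h2, h3, h4⟩ | ⟨h1, h2, h3, h4⟩ | ⟨h1, h2, h3, h4⟩)
  · linarith [e.1]
  · exact e.2.2 (by rw [h1, val_zero])
  · linarith [e.2.1]

/-- The invariant along the branch followed by `s` is that the matrix of the first `m` digits lies
in the cone of the node, and that the next digit is not the excluded one. -/
theorem exists_block_of_search {s : ℕ → Fin (c.lastDigit + 1)} (h₀ : s 0 ≠ Fin.last c.lastDigit)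
    (hpar : ∀ i : Fin (c.lastDigit + 1), c.par i = true → ¬ EndsWith s i) (k : ℕ) :
    ∀ (m mode : ℕ) (G : Mat (ZW c.ca c.cb)) (Gs : List (Mat (ZW c.ca c.cb)))
      (M : Mat (ZW c.ca c.cb)),
      search c.lastDigit c.par c.nmats c.dom k mode G Gs = true → G.Nonneg →
      (∀ G' ∈ Gs, G'.Nonneg) → Mat.InCone G Gs M → M.Nonneg →
      c.Represents ((subword s 0 m).map c.A).prod M → (s m).val ≠ mode →
      ∃ m', IsDecreasingBlock c.σ c.σ' c.A (subword s 0 m') := by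
  induction k with
  | zero => intro m mode G Gs M h; simp [search] at h
  | succ k ih =>
    intro m mode G Gs M h hG hGs hM hM0 hP hmode
    simp only [search, List.all_eq_true, List.mem_range] at h
    have hi := h (s m) (s m).2
    have hle : (s m).val ≤ c.lastDigit := Nat.lt_succ_iff.1 (s m).2
    have hB : (c.nmats (s m)).Nonneg := nmats_Nonneg hle
    rw [Bool.or_eq_true, Bool.or_eq_true, beq_iff_eq, or_iff_right hmode, Bool.and_eq_true,
      Bool.and_eq_true, bne_iff_ne] at hi
    rcases hi with ⟨⟨h1, h2⟩, h3⟩ | hi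
    · rcases m with _ | m
      · exact absurd (c.shapeCheck_spec h2 hGs hM) (not_shape_of_represents_one (by
          simpa [subword] using hP))
      · refine ⟨m + 2, ?_⟩
        rw [subword_succ' s 0 m] at hP
        rw [subword_succ, subword_succ']
        simp only [zero_add] at hP ⊢
        refine isDecreasingBlock_of_check h₀ ?_ hP hM0 hGs hM h2 h3
        intro h
        rw [h] at h1
        exact h1 (Fin.val_last _)
    · split_ifs at hi with hp
      · obtain ⟨-, hN, hBN⟩ := par_spec hp
        -- Without a parabolic tail the run ends; it has exactly `j + 1` digits for the least such
        -- `j`.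
        have hex : ∃ j, s (m + (j + 1)) ≠ s m := by
          by_contra! hcon
          refine hpar _ hp (eventually_atTop.2 ⟨m, fun n hn => ?_⟩)
          rcases hn.eq_or_lt with rfl | hn
          · rfl
          · have := hcon (n - m - 1)
            rwa [show m + (n - m - 1 + 1) = n by omega] at this
        classical
        set j := Nat.find hex with hj
        have hjs : s (m + (j + 1)) ≠ s m := Nat.find_spec hex
        have hjm : ∀ i < j + 1, s (m + i) = s m := by
          intro i hi
          rcases i with _ | i
          · rfl
          · exact not_not.1 (Nat.find_min hex (m := i) (by omega))
        have hpow : ((c.nmats (s m)).pow (j + 1)).Nonneg := by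
          induction j + 1 with
          | zero => simp [Mat.pow, Mat.one, Mat.Nonneg, embed_one, val_zero]
          | succ n ih => exact nonneg_mul c ih hB
        refine ih (m + (j + 1)) _ _ _ _ hi (nonneg_mul c hG hB) ?_ (hM.mul_pow hBN j)
          (nonneg_mul c hM0 hpow) (hP.run _ hjm) ?_
        · intro G' hG'
          rw [List.mem_append, List.mem_map, List.mem_map] at hG'
          rcases hG' with ⟨G₁, h1, rfl⟩ | ⟨G₁, h1, rfl⟩
          · exact nonneg_mul c (hGs _ h1) hB
          · refine nonneg_mul c ?_ hN
            rcases List.mem_cons.1 h1 with rfl | h1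
            · exact hG
            · exact hGs _ h1
        · exact fun h => hjs (Fin.ext h)
      · refine ih (m + 1) _ _ _ _ hi (nonneg_mul c hG hB) ?_ (hM.mul _) (nonneg_mul c hM0 hB)
          hP.snoc ?_
        · intro G' hG'
          obtain ⟨G₁, h1, rfl⟩ := List.mem_map.1 hG'
          exact nonneg_mul c (hGs _ h1) hB
        · exact (s (m + 1)).2.ne

/-- At the root the excluded digit is the last one, in accordance with `h₀`. -/
theorem exists_block {s : ℕ → Fin (c.lastDigit + 1)} (h₀ : s 0 ≠ Fin.last c.lastDigit)
    (hl : ¬ EndsWith s (Fin.last c.lastDigit))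
    (hz : (c.A 0).val.det = 1 → ¬ EndsWith s 0) :
    ∃ m, IsDecreasingBlock c.σ c.σ' c.A (subword s 0 m) := by
  refine exists_block_of_search h₀ ?_ 14 0 c.lastDigit Mat.one [] Mat.one c.searchTree_eq_true
    ?_ (by simp) .apex ?_ ?_ ?_
  · intro i hi
    simp only [par, Bool.or_eq_true, Bool.and_eq_true, beq_iff_eq] at hi
    rcases hi with hi | ⟨hi, hd⟩
    · rwa [show i = Fin.last c.lastDigit from Fin.ext hi]
    · rw [show i = 0 from Fin.ext hi]
      refine hz ?_
      rcases c.det_A_zero with h | h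
      · exact h.1
      · exact absurd (hd.symm.trans h.2) one_ne_neg_one
  · simp [Mat.one, Mat.Nonneg, embed_one, val_zero]
  · simp [Mat.one, Mat.Nonneg, embed_one, val_zero]
  · simpa [subword] using Represents.one
  · exact fun h => h₀ (Fin.ext h)

/-- The set of all decreasing blocks serves, so only the existence of a block is needed from the
search. -/
theorem isCompleteSet (c : Case) :
    IsCompleteSet c.σ c.σ' c.A {w | IsDecreasingBlock c.σ c.σ' c.A w} := by
  refine ⟨fun w hw => hw, ?_⟩
  rcases c.det_A_zero with h | h
  · exact Or.inr ⟨h.1, fun s h₀ hl hz => exists_block h₀ hl fun _ => hz⟩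
  · refine Or.inl ⟨h.1, fun s h₀ hl => exists_block h₀ hl fun h' => ?_⟩
    rw [h.1] at h'
    exact absurd h' (by norm_num)

end Case

/-! ### The height as a product over places -/

theorem iSup_fin_two (f : Fin 2 → ℝ) : ⨆ i, f i = max (f 0) (f 1) := by
  apply le_antisymm
  · refine ciSup_le fun i => ?_
    fin_cases i <;> simp
  · exact max_le (le_ciSup (Set.finite_range f).bddAbove 0) (le_ciSup (Set.finite_range f).bddAbove 1)

theorem height_ofPair {L : Type} [Field L] [DecidableEq L] [NumberField L] {p q : L}
    (h : p ≠ 0 ∨ q ≠ 0) :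
    height (ofPair p q) = Height.mulHeight ![p, q] ^ ((Module.finrank ℚ L : ℝ)⁻¹) := by
  have hv : (![p, q] : Fin 2 → L) ≠ 0 := by
    intro h0
    have h1 := congrFun h0 0
    have h2 := congrFun h0 1
    simp at h1 h2
    simp [h1, h2] at h
  have : OnePoint.equivProjectivization L (ofPair p q) = Projectivization.mk L ![p, q] hv := by
    rw [← Equiv.eq_symm_apply, OnePoint.equivProjectivization_symm_apply_mk]
    simp [ofPair, div_eq_inv_mul]
  rw [height, this, Projectivization.mulHeight_mk]

theorem rpow_finrank_le_iff {L : Type} [Field L] [NumberField L] {x y : ℝ} (hx : 0 ≤ x)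
    (hy : 0 ≤ y) : x ^ ((Module.finrank ℚ L : ℝ)⁻¹) ≤ y ^ ((Module.finrank ℚ L : ℝ)⁻¹) ↔ x ≤ y :=
  Real.rpow_le_rpow_iff hx hy (inv_pos.2 (by exact_mod_cast Module.finrank_pos))

theorem one_le_height {L : Type} [Field L] [DecidableEq L] [NumberField L] (x : OnePoint L) :
    1 ≤ height x := by
  rw [height]
  exact Real.one_le_rpow (Projectivization.one_le_mulHeight _) (by positivity)

theorem height_le_iff {L : Type} [Field L] [DecidableEq L] [NumberField L] (x y : OnePoint L) :
    height x ≤ height y ↔ (OnePoint.equivProjectivization L x).mulHeight ≤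
      (OnePoint.equivProjectivization L y).mulHeight :=
  rpow_finrank_le_iff (Projectivization.mulHeight_pos _).le (Projectivization.mulHeight_pos _).le

theorem height_coe_le_iff {L : Type} [Field L] [DecidableEq L] [NumberField L] (x : L)
    (y : OnePoint L) : height (x : OnePoint L) ≤ height y ↔
      Height.mulHeight₁ x ≤ (OnePoint.equivProjectivization L y).mulHeight := by
  rw [height_le_iff, OnePoint.equivProjectivization_apply_coe, Projectivization.mulHeight_mk,
    Height.mulHeight₁_eq_mulHeight]

theorem finite_height_le {L : Type} [Field L] [DecidableEq L] [NumberField L] (y : OnePoint L) :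
    {x : OnePoint L | height x ≤ height y}.Finite := by
  refine (((NumberField.finite_setOfPred_mulHeight₁_le L
    (OnePoint.equivProjectivization L y).mulHeight).image
      ((↑) : L → OnePoint L)).insert ∞).subset ?_
  intro x hx
  cases x with
  | infty => exact Or.inl rfl
  | coe x => exact Or.inr ⟨x, (height_coe_le_iff x y).1 hx, rfl⟩

theorem height_zero {L : Type} [Field L] [DecidableEq L] [NumberField L] :
    height ((0 : L) : OnePoint L) = 1 := by
  rw [height, OnePoint.equivProjectivization_apply_coe, Projectivization.mulHeight_mk,
    ← Height.mulHeight₁_eq_mulHeight, Height.mulHeight₁_zero, Real.one_rpow]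

theorem height_one {L : Type} [Field L] [DecidableEq L] [NumberField L] :
    height ((1 : L) : OnePoint L) = 1 := by
  rw [height, OnePoint.equivProjectivization_apply_coe, Projectivization.mulHeight_mk,
    ← Height.mulHeight₁_eq_mulHeight, Height.mulHeight₁_one, Real.one_rpow]

/-- A nonnegative number of height one is `0` or `1`. -/
theorem eq_zero_or_one_of_height {L : Type} [Field L] [DecidableEq L] [NumberField L]
    (σ : L →+* ℝ) {x : L} (hσ : 0 ≤ σ x) (hx : height (x : OnePoint L) = 1) : x = 0 ∨ x = 1 := by
  have h1 : Height.mulHeight₁ x = 1 := by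
    apply le_antisymm _ (Height.one_le_mulHeight₁ x)
    have := (height_coe_le_iff x ((1 : L) : OnePoint L)).1 (by rw [hx, height_one])
    rwa [OnePoint.equivProjectivization_apply_coe, Projectivization.mulHeight_mk,
      ← Height.mulHeight₁_eq_mulHeight, Height.mulHeight₁_one] at this
  have hfin := NumberField.finite_setOfPred_mulHeight₁_le L 1
  -- All powers of `x` have height one, so two of them coincide by Northcott's theorem. A
  -- nonnegative real number other than `0` and `1` has distinct powers.
  obtain ⟨m, -, n, -, hmn, h⟩ := Set.infinite_univ.exists_ne_map_eq_of_mapsTo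
    (f := fun n : ℕ => x ^ n) (fun n _ => by
      simp [Height.mulHeight₁_pow, h1]) hfin
  by_contra! hc
  have hpos : 0 < σ x := lt_of_le_of_ne hσ fun h0 => hc.1 ((map_eq_zero σ).1 h0.symm)
  have hne : σ x ≠ 1 := fun h1 => hc.2 (σ.injective (by rw [h1, map_one]))
  have := congrArg σ h
  simp only [map_pow] at this
  exact hmn (pow_right_injective₀ hpos hne this)

namespace Case

variable {c : Case}

/-- The infinite place given by a real embedding. -/
noncomputable def placeOf (f : c.K →+* ℝ) : NumberField.InfinitePlace c.K :=
  NumberField.InfinitePlace.mk (Complex.ofRealHom.comp f)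

theorem placeOf_apply (f : c.K →+* ℝ) (x : c.K) : placeOf f x = |f x| := by
  simp [placeOf]

theorem mult_placeOf (f : c.K →+* ℝ) : (placeOf f).mult = 1 := by
  apply NumberField.InfinitePlace.IsReal.mult_eq_one
  refine ⟨_, ?_, rfl⟩
  ext x
  simp

theorem sqrt_radicand_pos (c : Case) : 0 < √(c.radicand : ℝ) := by
  rw [Real.sqrt_pos]
  cases c <;> norm_num [radicand]

theorem placeOf_ne (c : Case) : placeOf c.σ ≠ placeOf c.σ' := by
  intro h
  have := congrArg (fun v : NumberField.InfinitePlace c.K => v ⟨1, 1⟩) h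
  simp only [placeOf_apply, embed_apply, embedConj_apply, Rat.cast_one, one_mul] at this
  have hp := c.sqrt_radicand_pos
  rcases abs_eq_abs.1 this with h | h <;> linarith

theorem eq_embed_or_embedConj (f : c.K →+* ℂ) :
    f = Complex.ofRealHom.comp c.σ ∨ f = Complex.ofRealHom.comp c.σ' := by
  have hs : ((√(c.radicand : ℝ) : ℝ) : ℂ) * (√(c.radicand : ℝ) : ℝ) = c.radicand := by
    rw [← Complex.ofReal_mul, Real.mul_self_sqrt (Nat.cast_nonneg _), Complex.ofReal_natCast]
  have hθ : f ⟨0, 1⟩ * f ⟨0, 1⟩ = c.radicand := by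
    rw [← map_mul, ← map_natCast f]
    congr 1
    ext <;> simp
  have hx : ∀ x : c.K, f x = x.re + x.im * f ⟨0, 1⟩ := by
    intro x
    rw [← map_ratCast f, ← map_ratCast f, ← map_mul, ← map_add]
    congr 1
    ext <;> simp
  rw [← hs, mul_self_eq_mul_self_iff] at hθ
  rcases hθ with h | h
  · left
    ext x
    rw [hx, h]
    simp [embed_apply]
  · right
    ext x
    rw [hx, h]
    simp [embedConj_apply, sub_eq_add_neg]

theorem prod_infinitePlace (f : NumberField.InfinitePlace c.K → ℝ) :
    ∏ v, f v ^ v.mult = f (placeOf c.σ) * f (placeOf c.σ') := by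
  classical
  have : (Finset.univ : Finset (NumberField.InfinitePlace c.K)) = {placeOf c.σ, placeOf c.σ'} := by
    ext v
    simp only [Finset.mem_univ, Finset.mem_insert, Finset.mem_singleton, true_iff]
    rw [← NumberField.InfinitePlace.mk_embedding v]
    rcases eq_embed_or_embedConj v.embedding with h | h
    · exact Or.inl (by rw [h, placeOf])
    · exact Or.inr (by rw [h, placeOf])
  rw [this, Finset.prod_pair c.placeOf_ne, mult_placeOf, mult_placeOf, pow_one, pow_one]

/-- The contribution of the finite places to the height. -/
noncomputable def finHeight (p q : c.K) : ℝ :=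
  ∏ᶠ w : NumberField.FinitePlace c.K, max (w p) (w q)

theorem mulHeight_pair {p q : c.K} (h : p ≠ 0 ∨ q ≠ 0) :
    Height.mulHeight ![p, q] =
      (max |c.σ p| |c.σ q| * max |c.σ' p| |c.σ' q|) * finHeight p q := by
  have hv : (![p, q] : Fin 2 → c.K) ≠ 0 := by
    intro h0
    have h1 := congrFun h0 0
    have h2 := congrFun h0 1
    simp at h1 h2
    simp [h1, h2] at h
  rw [NumberField.mulHeight_eq hv, prod_infinitePlace]
  simp only [iSup_fin_two, placeOf_apply, finHeight]
  rfl

theorem finitePlace_le_one (w : NumberField.FinitePlace c.K) (z : ZW c.ca c.cb) :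
    w (c.phi z) ≤ 1 := by
  have := NumberField.FinitePlace.norm_le_one c.K w.maximalIdeal
    (⟨c.phi z, c.isIntegral_phi z⟩ : NumberField.RingOfIntegers c.K)
  rwa [NumberField.FinitePlace.norm_embedding_eq] at this

theorem finitePlace_mul_add_le (w : NumberField.FinitePlace c.K) (x y : ZW c.ca c.cb) (p q : c.K) :
    w (c.phi x * p + c.phi y * q) ≤ max (w p) (w q) := by
  refine (NumberField.FinitePlace.add_le w _ _).trans ?_
  rw [map_mul, map_mul]
  exact max_le_max (mul_le_of_le_one_left (apply_nonneg w p) (finitePlace_le_one w x))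
    (mul_le_of_le_one_left (apply_nonneg w q) (finitePlace_le_one w y))

/-- Both `M` and its inverse `det M * adj M` have integral entries. By the ultrametric inequality
neither of them increases the maximum at any finite place. -/
theorem finHeight_mul {M : Mat (ZW c.ca c.cb)} (hM : M.det = 1 ∨ M.det = -1) (p q : c.K) :
    finHeight (c.phi M.a * p + c.phi M.b * q) (c.phi M.c * p + c.phi M.d * q) =
      finHeight p q := by
  unfold finHeight
  congr 1
  ext w
  apply le_antisymm
  · exact max_le (finitePlace_mul_add_le w _ _ _ _) (finitePlace_mul_add_le w _ _ _ _)
  · set p' := c.phi M.a * p + c.phi M.b * q with hp'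
    set q' := c.phi M.c * p + c.phi M.d * q with hq'
    have hd : c.phi M.det * c.phi M.det = 1 := by
      rcases hM with h | h <;> simp [h]
    have e1 : p = c.phi (M.det * M.d) * p' + c.phi (-(M.det * M.b)) * q' := by
      refine (one_mul p).symm.trans ?_
      rw [hp', hq', ← hd]
      simp only [Mat.det, map_mul, map_neg, map_sub]
      ring
    have e2 : q = c.phi (-(M.det * M.c)) * p' + c.phi (M.det * M.a) * q' := by
      refine (one_mul q).symm.trans ?_
      rw [hp', hq', ← hd]
      simp only [Mat.det, map_mul, map_neg, map_sub]
      ring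
    apply max_le
    · nth_rewrite 1 [e1]
      exact finitePlace_mul_add_le w _ _ _ _
    · nth_rewrite 1 [e2]
      exact finitePlace_mul_add_le w _ _ _ _

end Case

/-! ### The height along a decreasing block -/

namespace Case

variable {c : Case} {P : GL (Fin 2) c.K} {M : Mat (ZW c.ca c.cb)}

theorem Represents.continuous_growth (hP : c.Represents P M) :
    Continuous fun y : ℝ => growth c.σ P (y : OnePoint ℝ) := by
  simp only [hP.growth_coe]
  exact Continuous.div (by fun_prop) (by fun_prop) fun y => (by positivity)

theorem Represents.threshold_le_growth (hP : c.Represents P M) {y : ℝ}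
    (hy : (y : OnePoint ℝ) ∈ closure (sharpSet c.σ c.σ' P)) :
    threshold c.σ' P ≤ growth c.σ P (y : OnePoint ℝ) := by
  by_contra! hlt
  have hopen : IsOpen (((↑) : ℝ → OnePoint ℝ) ''
      {z : ℝ | growth c.σ P (z : OnePoint ℝ) < threshold c.σ' P}) :=
    OnePoint.isOpenEmbedding_coe.isOpenMap _ (isOpen_lt hP.continuous_growth continuous_const)
  obtain ⟨_, ⟨z, hz, rfl⟩, hz'⟩ := mem_closure_iff.1 hy _ hopen ⟨y, hlt, rfl⟩
  exact lt_asymm hz hz'.2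

theorem exists_mem_sharpSet_of_closure {l u z : ℝ} (hz : z ∈ Set.Ioo l u)
    (hc : (z : OnePoint ℝ) ∈ closure (sharpSet c.σ c.σ' P)) :
    ∃ y ∈ Set.Ioo l u, (y : OnePoint ℝ) ∈ sharpSet c.σ c.σ' P := by
  have hopen : IsOpen (((↑) : ℝ → OnePoint ℝ) '' Set.Ioo l u) :=
    OnePoint.isOpenEmbedding_coe.isOpenMap _ isOpen_Ioo
  obtain ⟨_, ⟨y, hy, rfl⟩, hy'⟩ := mem_closure_iff.1 hc _ hopen ⟨z, hz, rfl⟩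
  exact ⟨y, hy, hy'⟩

/-- The function `f` is nondecreasing on `[0, 1]`, where its denominator is `1`, and nonincreasing
on `[1, ∞)`, where it is the maximum of `a + b / x` and `c + d / x`. -/
theorem Represents.lt_growth_of_between (hP : c.Represents P M) (hM : M.Nonneg) {y x z t : ℝ}
    (hy : 0 ≤ y) (hyx : y < x) (hxz : x < z) (h₁ : t < growth c.σ P (y : OnePoint ℝ))
    (h₂ : t < growth c.σ P (z : OnePoint ℝ)) : t < growth c.σ P (x : OnePoint ℝ) := by
  obtain ⟨m1, m2, m3, m4⟩ := hM
  have hx : 0 < x := hy.trans_lt hyx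
  have hz : 0 < z := hx.trans hxz
  rw [hP.growth_coe, lt_div_iff₀ (by positivity), abs_of_nonneg (by positivity),
    abs_of_nonneg (by positivity)] at h₁ h₂ ⊢
  rcases le_total x 1 with hx1 | hx1
  · rw [max_eq_right hx1]
    rw [max_eq_right (hyx.le.trans hx1)] at h₁
    refine h₁.trans_le (max_le_max ?_ ?_)
    · linarith [mul_le_mul_of_nonneg_left hyx.le m1]
    · linarith [mul_le_mul_of_nonneg_left hyx.le m3]
  · rw [max_eq_left hx1]
    rw [max_eq_left (hx1.trans hxz.le)] at h₂
    have key : ∀ a b : ℝ, 0 ≤ b → t * z < a * z + b → t * x < a * x + b := by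
      intro a b hb h
      have h1 : (t - a) * z * x < b * x := by
        apply mul_lt_mul_of_pos_right _ hx
        linarith
      have h2 : b * x ≤ b * z := mul_le_mul_of_nonneg_left hxz.le hb
      have h3 : (t - a) * x * z < b * z := by linarith
      have := lt_of_mul_lt_mul_right h3 hz.le
      linarith
    rcases lt_max_iff.1 h₂ with h | h
    · exact lt_max_of_lt_left (key _ _ m2 h)
    · exact lt_max_of_lt_right (key _ _ m4 h)

/-- If `x` were interior to `I`, there would be points of `E♯` on both sides of it, and unimodality
of `f` would give strict inequality at `x`. -/
theorem Represents.mem_frontier (hP : c.Represents P M) (hM : M.Nonneg) {I : Set (OnePoint ℝ)}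
    {x : ℝ} (hx : (x : OnePoint ℝ) ∈ I) (hI : I ⊆ closure (sharpSet c.σ c.σ' P))
    (ht : growth c.σ P (x : OnePoint ℝ) = threshold c.σ' P) :
    (x : OnePoint ℝ) ∈ frontier (sharpSet c.σ c.σ' P) ∩ frontier I := by
  refine ⟨⟨hI hx, fun h => ?_⟩, subset_closure hx, fun h => ?_⟩
  · exact (interior_subset h).2.ne' ht
  · have hopen : IsOpen (((↑) : ℝ → OnePoint ℝ) ⁻¹' interior I) :=
      isOpen_interior.preimage OnePoint.continuous_coe
    obtain ⟨ε, hε, hball⟩ := Metric.isOpen_iff.1 hopen x h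
    have hmem : ∀ z : ℝ, |z - x| < ε → (z : OnePoint ℝ) ∈ closure (sharpSet c.σ c.σ' P) :=
      fun z hz => hI (interior_subset (hball (by rwa [Metric.mem_ball, Real.dist_eq])))
    obtain ⟨y, ⟨-, hy2⟩, hy⟩ := exists_mem_sharpSet_of_closure (l := x - ε) (u := x)
      (z := x - ε / 2) ⟨by linarith, by linarith⟩ (hmem _ (by
        rw [abs_lt]; constructor <;> linarith))
    obtain ⟨z, ⟨hz1, -⟩, hz⟩ := exists_mem_sharpSet_of_closure (l := x) (u := x + ε)
      (z := x + ε / 2) ⟨by linarith, by linarith⟩ (hmem _ (by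
        rw [abs_lt]; constructor <;> linarith))
    have := hP.lt_growth_of_between hM (coe_mem_baseInterval.1 hy.1) hy2 hz1 hy.2 hz.2
    exact this.ne' ht

theorem Represents.smul_ofPair (hP : c.Represents P M) {p q : c.K} (h : p ≠ 0 ∨ q ≠ 0) :
    P • ofPair p q =
      ofPair (c.phi M.a * p + c.phi M.b * q) (c.phi M.c * p + c.phi M.d * q) := by
  rw [QuadGauss.smul_ofPair _ h]
  rcases hP.entries with ⟨h1, h2, h3, h4⟩ | ⟨h1, h2, h3, h4⟩ <;> rw [h1, h2, h3, h4]
  rw [← ofPair_mul _ _ (neg_ne_zero.2 one_ne_zero : (-1 : c.K) ≠ 0)]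
  ring_nf

theorem Represents.pair_ne_zero (hP : c.Represents P M) {p q : c.K} (h : p ≠ 0 ∨ q ≠ 0) :
    c.phi M.a * p + c.phi M.b * q ≠ 0 ∨ c.phi M.c * p + c.phi M.d * q ≠ 0 := by
  have := smul_pair_ne_zero P h
  rcases hP.entries with ⟨h1, h2, h3, h4⟩ | ⟨h1, h2, h3, h4⟩ <;> rw [h1, h2, h3, h4] at this
  · exact this
  · have e : ∀ x y : c.K, -x * p + -y * q = -(x * p + y * q) := by intro x y; ring
    rwa [e, e, neg_ne_zero, neg_ne_zero] at this

/-- The sup norm of the inverse of a matrix of determinant `±1`. -/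
theorem max_le_mul_max {a b e d x : ℝ} (hd : a * d - b * e = 1 ∨ a * d - b * e = -1) :
    |x| ≤ |d| * |a * x + b| + |b| * |e * x + d| ∧ 1 ≤ |e| * |a * x + b| + |a| * |e * x + d| := by
  have h1 : (a * d - b * e) * x = d * (a * x + b) - b * (e * x + d) := by ring
  have h2 : a * d - b * e = a * (e * x + d) - e * (a * x + b) := by ring
  have t1 := abs_sub (d * (a * x + b)) (b * (e * x + d))
  have t2 := abs_sub (a * (e * x + d)) (e * (a * x + b))
  rw [← h1, abs_mul, abs_mul d, abs_mul b] at t1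
  rw [← h2, abs_mul a, abs_mul e] at t2
  have : |a * d - b * e| = 1 := by rcases hd with h | h <;> simp [h]
  rw [this] at t1 t2
  exact ⟨by linarith, by linarith⟩

/-- This is the equality case of the bound by the operator norm: with nonzero coefficients, both
coordinates must attain the maximum. -/
theorem abs_eq_of_extremal {a b u v t : ℝ} (ha : a ≠ 0) (hb : b ≠ 0) (ht : |a| + |b| ≤ t)
    (h : t * max |u| |v| ≤ |a| * |u| + |b| * |v|) : |u| = |v| := by
  have ha' := abs_pos.2 ha
  have hb' := abs_pos.2 hb
  have hm : 0 ≤ max |u| |v| := le_max_of_le_left (abs_nonneg u)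
  have h1 := (mul_le_mul_of_nonneg_right ht hm).trans h
  rcases le_total |u| |v| with huv | huv
  · rw [max_eq_right huv] at h1
    exact le_antisymm huv (le_of_mul_le_mul_left (by linarith) ha')
  · rw [max_eq_left huv] at h1
    exact le_antisymm (le_of_mul_le_mul_left (by linarith) hb') huv

theorem val_conj_det (hd : M.det = 1 ∨ M.det = -1) :
    M.a.conj.val * M.d.conj.val - M.b.conj.val * M.c.conj.val = 1 ∨
      M.a.conj.val * M.d.conj.val - M.b.conj.val * M.c.conj.val = -1 := by
  simp only [← embedConj_phi, ← map_mul, ← map_sub]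
  rcases hd with h | h <;> simp only [Mat.det] at h <;> simp [h]

/-- Since `a y + b ≤ (a + b) (y ∨ 1)`, the function `f` never exceeds the larger row sum. This
excludes `β = 1` in the equality case below. -/
theorem sharpSet_eq_empty (hP : c.Represents P M) (hM : M.Nonneg)
    (h₁ : M.a.val + M.b.val ≤ threshold c.σ' P) (h₂ : M.c.val + M.d.val ≤ threshold c.σ' P) :
    sharpSet c.σ c.σ' P = ∅ := by
  obtain ⟨m1, m2, m3, m4⟩ := hM
  rw [Set.eq_empty_iff_forall_notMem]
  rintro z ⟨hz, hlt⟩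
  cases z with
  | infty =>
    rw [hP.growth_infty, abs_of_nonneg m1, abs_of_nonneg m3] at hlt
    rcases lt_max_iff.1 hlt with h | h <;> linarith
  | coe y =>
    have hy := coe_mem_baseInterval.1 hz
    rw [hP.growth_coe, lt_div_iff₀ (by positivity), abs_of_nonneg (by positivity),
      abs_of_nonneg (by positivity)] at hlt
    have key : ∀ a b t : ℝ, 0 ≤ a → 0 ≤ b → a + b ≤ t → a * y + b ≤ t * max y 1 := by
      intro a b t ha hb hab
      have e1 := mul_le_mul_of_nonneg_left (le_max_left y 1) ha
      have e2 := mul_le_mul_of_nonneg_left (le_max_right y 1) hb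
      have e3 := mul_le_mul_of_nonneg_right hab (le_max_of_le_left hy : 0 ≤ max y 1)
      linarith
    rcases lt_max_iff.1 hlt with h | h
    · linarith [key _ _ _ m1 m2 h₁]
    · linarith [key _ _ _ m3 m4 h₂]

/-- The main estimate: the height decreases along a decreasing block. -/
theorem height_block (hP : c.Represents P M) (hM : M.Nonneg) (hd : M.det = 1 ∨ M.det = -1)
    {I : Set (OnePoint ℝ)} (hI : I ⊆ closure (sharpSet c.σ c.σ' P))
    (hz : (∃ i j, P i j = 0) → ∀ β : c.K, ((c.σ β : ℝ) : OnePoint ℝ) ∈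
      frontier (sharpSet c.σ c.σ' P) ∩ frontier I →
        max |c.σ' β| 1 < threshold c.σ' P *
          max |c.σ' (P 0 0) * c.σ' β + c.σ' (P 0 1)| |c.σ' (P 1 0) * c.σ' β + c.σ' (P 1 1)|)
    {β : c.K} (hβ : ((c.σ β : ℝ) : OnePoint ℝ) ∈ I) :
    height (β : OnePoint c.K) ≤ height (P • (β : OnePoint c.K)) ∧
      (height (β : OnePoint c.K) = height (P • (β : OnePoint c.K)) →
        P • (β : OnePoint c.K) = ((1 : c.K) : OnePoint c.K) ∧ β = 0) := by
  have hne : β ≠ 0 ∨ (1 : c.K) ≠ 0 := Or.inr one_ne_zero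
  have hβ0 : 0 ≤ c.σ β := coe_mem_baseInterval.1
    (closure_minimal (fun x hx => hx.1) isClosed_baseInterval (hI hβ))
  have hg := hP.threshold_le_growth (hI hβ)
  have hconj := hP.conj_row (c.σ' β)
  rw [hP.growth_coe, le_div_iff₀ (by positivity)] at hg
  have hsm := hP.smul_ofPair hne
  have hpne := hP.pair_ne_zero hne
  have hH1 := mulHeight_pair hne
  have hH2 := mulHeight_pair hpne
  rw [finHeight_mul hd] at hH2
  have hpos1 := Height.mulHeight_pos ![β, 1]
  have hpos2 := Height.mulHeight_pos ![c.phi M.a * β + c.phi M.b * 1, c.phi M.c * β + c.phi M.d * 1]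
  simp only [map_add, map_mul, map_one, abs_one, embed_phi, embedConj_phi, mul_one] at hH1 hH2
  rw [abs_of_nonneg hβ0] at hH1
  -- The conjugate coordinates of `β` are recovered by the adjugate, whose largest absolute row sum
  -- is the threshold.
  have hV : max |c.σ' β| 1 ≤ threshold c.σ' P * max |M.a.conj.val * c.σ' β + M.b.conj.val|
      |M.c.conj.val * c.σ' β + M.d.conj.val| := by
    obtain ⟨t1, t2⟩ := max_le_mul_max (x := c.σ' β) (val_conj_det hd)
    rw [hP.threshold_eq, Mat.tval]
    set W := max |M.a.conj.val * c.σ' β + M.b.conj.val| |M.c.conj.val * c.σ' β + M.d.conj.val|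
    have w1 : |M.a.conj.val * c.σ' β + M.b.conj.val| ≤ W := le_max_left _ _
    have w2 : |M.c.conj.val * c.σ' β + M.d.conj.val| ≤ W := le_max_right _ _
    have w0 : 0 ≤ W := (abs_nonneg _).trans w1
    apply max_le
    · refine t1.trans (le_trans ?_ (mul_le_mul_of_nonneg_right (le_max_right _ _) w0))
      linarith [mul_le_mul_of_nonneg_left w1 (abs_nonneg M.d.conj.val),
        mul_le_mul_of_nonneg_left w2 (abs_nonneg M.b.conj.val)]
    · refine t2.trans (le_trans ?_ (mul_le_mul_of_nonneg_right (le_max_left _ _) w0))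
      linarith [mul_le_mul_of_nonneg_left w1 (abs_nonneg M.c.conj.val),
        mul_le_mul_of_nonneg_left w2 (abs_nonneg M.a.conj.val)]
  have hFpos : 0 < finHeight β 1 := by
    refine pos_of_mul_pos_right (hH1 ▸ hpos1) ?_
    positivity
  have hW0 : 0 ≤ max |M.a.conj.val * c.σ' β + M.b.conj.val|
      |M.c.conj.val * c.σ' β + M.d.conj.val| := le_max_of_le_left (abs_nonneg _)
  have hX1 : (1 : ℝ) ≤ max (c.σ β) 1 := le_max_right _ _
  have hle : Height.mulHeight ![β, 1] ≤
      Height.mulHeight ![c.phi M.a * β + c.phi M.b * 1, c.phi M.c * β + c.phi M.d * 1] := by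
    simp only [mul_one]
    rw [hH1, hH2]
    apply mul_le_mul_of_nonneg_right _ hFpos.le
    calc _ ≤ max (c.σ β) 1 * _ := mul_le_mul_of_nonneg_left hV (by positivity)
      _ = threshold c.σ' P * max (c.σ β) 1 * _ := by ring
      _ ≤ _ := mul_le_mul_of_nonneg_right hg hW0
  rw [← ofPair_one β, hsm, height_ofPair hne, height_ofPair hpne]
  refine ⟨(rpow_finrank_le_iff hpos1.le hpos2.le).2 hle, fun heq => ?_⟩
  have hHeq := hle.antisymm ((rpow_finrank_le_iff (L := c.K) hpos2.le hpos1.le).1 heq.ge)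
  have hheight : height (β : OnePoint c.K) = height (P • (β : OnePoint c.K)) := by
    rw [← ofPair_one β, hsm, height_ofPair hne, height_ofPair hpne, hHeq]
  simp only [mul_one] at hHeq hpne ⊢
  rw [hH1, hH2] at hHeq
  have hprod := mul_right_cancel₀ hFpos.ne' hHeq
  have hgrowth := hP.growth_coe (c.σ β)
  set t := threshold c.σ' P with ht
  set V := max |c.σ' β| 1 with hVdef
  set W := max |M.a.conj.val * c.σ' β + M.b.conj.val| |M.c.conj.val * c.σ' β + M.d.conj.val| with hW
  set G := max |M.a.val * c.σ β + M.b.val| |M.c.val * c.σ β + M.d.val| with hG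
  set X := max (c.σ β) 1 with hX
  have hV1 : 1 ≤ V := le_max_right _ _
  have hWpos : 0 < W := lt_of_le_of_ne hW0 fun h => by rw [← h, mul_zero] at hV; linarith
  have e1 : X * V ≤ X * (t * W) := mul_le_mul_of_nonneg_left hV (by linarith)
  have e2 : t * X * W ≤ G * W := mul_le_mul_of_nonneg_right hg hW0
  -- Equal heights turn the whole chain `X V ≤ X t W ≤ G W` into equalities, and the positive
  -- factors cancel.
  have hGt : G = t * X := mul_right_cancel₀ hWpos.ne' (by linarith)
  have hVt : V = t * W := mul_left_cancel₀ (by linarith : X ≠ 0) (by linarith)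
  by_cases hzero : ∃ i j, P i j = 0
  · exfalso
    have := hz hzero β (hP.mem_frontier hM hβ hI (by
      rw [hgrowth, hGt, mul_div_cancel_right₀ _ (by linarith)]))
    rw [hconj.1, hconj.2] at this
    exact this.ne hVt
  · have hnz : M.a.conj.val ≠ 0 ∧ M.b.conj.val ≠ 0 ∧ M.c.conj.val ≠ 0 ∧ M.d.conj.val ≠ 0 := by
      simp only [← embedConj_phi, ne_eq, map_eq_zero c.σ']
      push Not at hzero
      rcases hP.entries with ⟨h1, h2, h3, h4⟩ | ⟨h1, h2, h3, h4⟩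
      · rw [← h1, ← h2, ← h3, ← h4]
        exact ⟨hzero _ _, hzero _ _, hzero _ _, hzero _ _⟩
      · refine ⟨fun h => hzero 0 0 ?_, fun h => hzero 0 1 ?_, fun h => hzero 1 0 ?_,
          fun h => hzero 1 1 ?_⟩ <;> simp [*]
    obtain ⟨n1, n2, n3, n4⟩ := hnz
    have habs : |M.a.conj.val * c.σ' β + M.b.conj.val| = |M.c.conj.val * c.σ' β + M.d.conj.val| := by
      obtain ⟨t1, t2⟩ := max_le_mul_max (x := c.σ' β) (val_conj_det hd)
      have ht' : t = M.tval := hP.threshold_eq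
      rw [Mat.tval] at ht'
      rcases le_total |c.σ' β| 1 with h | h
      · rw [hVdef, max_eq_right h] at hVt
        refine abs_eq_of_extremal n3 n1 (t := t) ?_ (by rw [← hW, ← hVt]; exact t2)
        rw [ht', add_comm]
        exact le_max_left _ _
      · rw [hVdef, max_eq_left h] at hVt
        refine abs_eq_of_extremal n4 n2 (t := t) ?_ (by rw [← hW, ← hVt]; exact t1)
        rw [ht', add_comm]
        exact le_max_right _ _
    obtain ⟨m1, m2, m3, m4⟩ := id hM
    -- Up to sign, equality passes from the conjugates to the field. With the minus sign,
    -- nonnegativity in the given embedding makes both coordinates vanish.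
    have hpairs : c.phi M.a * β + c.phi M.b = c.phi M.c * β + c.phi M.d := by
      rcases abs_eq_abs.1 habs with h | h
      · apply c.σ'.injective
        simpa only [map_add, map_mul, embedConj_phi] using h
      · have h' : c.phi M.a * β + c.phi M.b = -(c.phi M.c * β + c.phi M.d) := by
          apply c.σ'.injective
          simpa only [map_add, map_mul, map_neg, embedConj_phi] using h
        have h'' := congrArg c.σ h'
        simp only [map_add, map_mul, map_neg, embed_phi] at h''
        have p1 : 0 ≤ M.a.val * c.σ β + M.b.val := by positivity
        have p2 : 0 ≤ M.c.val * c.σ β + M.d.val := by positivity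
        have z2 : c.phi M.c * β + c.phi M.d = 0 := by
          apply c.σ.injective
          simp only [map_add, map_mul, map_zero, embed_phi]
          linarith
        rw [h', z2, neg_zero]
    have hone : P • (β : OnePoint c.K) = ((1 : c.K) : OnePoint c.K) := by
      rw [← ofPair_one β, hsm]
      simp only [mul_one]
      rw [← hpairs] at hpne ⊢
      have : c.phi M.a * β + c.phi M.b ≠ 0 := by simpa using hpne
      rw [ofPair, if_neg this, div_self this]
    have hH : height (β : OnePoint c.K) = 1 := by rw [hheight, hone, height_one]
    refine ⟨?_, ?_⟩
    · rw [← hone, ← ofPair_one β, hsm]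
      simp only [mul_one]
    · rcases eq_zero_or_one_of_height c.σ hβ0 hH with h | h
      · exact h
      -- For `β = 1` both row sums would equal the threshold, so `E♯` would be empty, although its
      -- closure contains `β`.
      · exfalso
        have hs := congrArg c.σ hpairs
        simp only [map_add, embed_phi, h, mul_one] at hs
        have hX1' : X = 1 := by rw [hX, h, map_one, max_self]
        have hGe : G = M.a.val + M.b.val := by
          rw [hG, h, map_one, mul_one, mul_one, hs, max_self, abs_of_nonneg (by positivity)]
        rw [hX1', mul_one, hGe] at hGt
        have hemp := sharpSet_eq_empty hP hM hGt.le (hs ▸ hGt.le)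
        have := hI hβ
        rw [hemp, closure_empty] at this
        exact this

end Case

/-! ### Orbits, splittings into blocks and parabolic fixed points -/

namespace Case

variable {c : Case}

theorem isIntegral_A (a : Fin (c.lastDigit + 1)) (i j : Fin 2) : IsIntegral ℤ (c.A a i j) := by
  have h := c.isIntegral_phi
  rcases (represents_A a).entries with ⟨h1, h2, h3, h4⟩ | ⟨h1, h2, h3, h4⟩ <;>
    fin_cases i <;> fin_cases j <;> simp [h1, h2, h3, h4, h, (h _).neg]

theorem exists_represents (w : List (Fin (c.lastDigit + 1))) :
    ∃ M : Mat (ZW c.ca c.cb), c.Represents (w.map c.A).prod M ∧ M.Nonneg ∧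
      (M.det = 1 ∨ M.det = -1) := by
  induction w with
  | nil =>
    refine ⟨Mat.one, by simpa using Represents.one, ?_, ?_⟩
    · simp [Mat.one, Mat.Nonneg, embed_one, val_zero]
    · simp [Mat.one, Mat.det]
  | cons a w ih =>
    obtain ⟨M, h1, h2, h3⟩ := ih
    have ha : a.val ≤ c.lastDigit := Nat.lt_succ_iff.1 a.2
    refine ⟨(c.nmats a).mul M, by simpa using (represents_A a).mul h1,
      nonneg_mul c (nmats_Nonneg ha) h2, ?_⟩
    have : ((c.nmats a).mul M).det = (c.nmats a).det * M.det := by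
      simp only [Mat.det, Mat.mul]
      ring
    rw [this]
    rcases c.nmats_det ha with h | h <;> rcases h3 with h3 | h3 <;> simp [h, h3]

theorem exists_coe_of_mem_interval {i : Fin (c.lastDigit + 1)} (hi : i ≠ Fin.last c.lastDigit)
    {x : OnePoint c.K} (hx : OnePoint.map c.σ x ∈ interval c.σ (c.A i)) :
    ∃ β : c.K, x = β := by
  cases x with
  | infty =>
    exfalso
    have hi' : i.val < c.lastDigit := Fin.val_lt_last hi
    obtain ⟨y, hy, h⟩ := hx
    simp only [OnePoint.map_infty] at h
    rcases hy with rfl | ⟨z, hz, rfl⟩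
    · rw [map_smul_infty hi'] at h
      exact OnePoint.coe_ne_infty _ h
    · rw [map_smul_coe hi' hz] at h
      exact OnePoint.coe_ne_infty _ h
  | coe β => exact ⟨β, rfl⟩

theorem iterate_eq_smul {s : ℕ → Fin (c.lastDigit + 1)} {α : OnePoint c.K} {N : ℕ}
    (h : ∀ k < N, OnePoint.map c.σ (c.T^[k] α) ∈ interval c.σ (c.A (s k))) (i m : ℕ)
    (him : i + m ≤ N) :
    c.T^[i] α = ((subword s i m).map c.A).prod • c.T^[i + m] α := by
  induction m with
  | zero => simp [subword]
  | succ m ih =>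
    rw [ih (by omega), subword_succ, List.map_append, List.prod_append, mul_smul]
    congr 1
    rw [← add_assoc, Function.iterate_succ_apply', c.T_eq (h (i + m) (by omega))]
    simp

/-- The height decreases along the blocks of a symbolic orbit. -/
theorem height_le_of_block {s : ℕ → Fin (c.lastDigit + 1)} {α : OnePoint c.K} {N : ℕ}
    (h : ∀ k < N, OnePoint.map c.σ (c.T^[k] α) ∈ interval c.σ (c.A (s k))) {i j : ℕ}
    (hij : i < j) (hj : j < N)
    (hb : IsDecreasingBlock c.σ c.σ' c.A (subword s i (j - i + 1))) :
    height (c.T^[j] α) ≤ height (c.T^[i] α) ∧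
      (height (c.T^[j] α) = height (c.T^[i] α) ↔ c.T^[i] α = ((1 : c.K) : OnePoint c.K)) ∧
      (c.T^[i] α = ((1 : c.K) : OnePoint c.K) → c.T^[j] α = ((0 : c.K) : OnePoint c.K)) := by
  obtain ⟨b₀, v, bu, P, hw, hP, -, hbu, hI, hz⟩ := hb
  rw [subword_succ, ← List.cons_append] at hw
  obtain ⟨hw1, hw2⟩ := List.append_inj' hw rfl
  rw [List.singleton_inj, Nat.add_sub_cancel' hij.le] at hw2
  have hit := iterate_eq_smul h i (j - i) (by omega)
  rw [hw1, ← hP, Nat.add_sub_cancel' hij.le] at hit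
  have hmem := h j hj
  rw [hw2] at hmem
  obtain ⟨β, hβ⟩ := exists_coe_of_mem_interval hbu hmem
  rw [hβ, OnePoint.map_some] at hmem
  obtain ⟨M, hM1, hM2, hM3⟩ := exists_represents (b₀ :: v)
  rw [← hP] at hM1
  obtain ⟨hle, heq⟩ := height_block hM1 hM2 hM3 hI hz hmem
  rw [← hβ, ← hit] at hle heq
  -- The point `1` has the least possible height, so the inequality cannot be strict.
  have hone : c.T^[i] α = ((1 : c.K) : OnePoint c.K) →
      height (c.T^[j] α) = height (c.T^[i] α) := by
    intro h1
    refine le_antisymm hle ?_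
    rw [h1, height_one]
    exact one_le_height _
  refine ⟨hle, ⟨fun h' => (heq h').1, hone⟩, fun h1 => ?_⟩
  rw [hβ, (heq (hone h1)).2]

theorem endsWith_shift {n : ℕ} {s : ℕ → Fin (n + 1)} {b : Fin (n + 1)} {i : ℕ}
    (h : EndsWith (fun k => s (i + k)) b) : EndsWith s b := by
  obtain ⟨k, hk⟩ := eventually_atTop.1 h
  refine eventually_atTop.2 ⟨i + k, fun m hm => ?_⟩
  have : s (i + (m - i)) = b := hk (m - i) (by omega)
  rwa [show i + (m - i) = m by omega] at this

/-- A block ends in a digit other than the last one of the alphabet, so the next block can start at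
that same digit. -/
theorem exists_next {s : ℕ → Fin (c.lastDigit + 1)} (hl : ¬ EndsWith s (Fin.last c.lastDigit))
    (hz : (c.A 0).val.det = 1 → ¬ EndsWith s 0) (i : ℕ) (hi : s i ≠ Fin.last c.lastDigit) :
    ∃ j, i < j ∧ s j ≠ Fin.last c.lastDigit ∧
      IsDecreasingBlock c.σ c.σ' c.A (subword s i (j - i + 1)) := by
  obtain ⟨m, hm⟩ := exists_block (c := c) (s := fun k => s (i + k)) (by simpa using hi)
    (fun h => hl (endsWith_shift h)) (fun hd h => hz hd (endsWith_shift h))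
  have he : subword (fun k => s (i + k)) 0 m = subword s i m := by simp [subword]
  rw [he] at hm
  obtain ⟨b₀, v, bu, P, hw, -, -, hbu, -, -⟩ := id hm
  have hlen := congrArg List.length hw
  simp only [subword, List.length_map, List.length_range, List.length_cons, List.length_append,
    List.length_nil] at hlen
  refine ⟨i + v.length + 1, by omega, ?_, ?_⟩
  · rw [hlen, subword_succ, ← List.cons_append] at hw
    have := (List.append_inj' hw rfl).2
    rw [List.singleton_inj] at this
    rw [add_assoc, this]
    exact hbu
  · rwa [show i + v.length + 1 - i + 1 = m by omega]

theorem exists_splitting {s : ℕ → Fin (c.lastDigit + 1)}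
    (hl : ¬ EndsWith s (Fin.last c.lastDigit)) (hz : (c.A 0).val.det = 1 → ¬ EndsWith s 0) :
    ∃ t : ℕ → ℕ, StrictMono t ∧ (∀ i < t 0, s i = Fin.last c.lastDigit) ∧
      ∀ k, IsDecreasingBlock c.σ c.σ' c.A (subword s (t k) (t (k + 1) - t k + 1)) := by
  classical
  have hex : ∃ i, s i ≠ Fin.last c.lastDigit := by
    by_contra! hcon
    exact hl (Eventually.of_forall hcon)
  choose! next h1 h2 h3 using exists_next hl hz
  let t : ℕ → ℕ := fun k => next^[k] (Nat.find hex)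
  have ht : ∀ k, s (t k) ≠ Fin.last c.lastDigit := by
    intro k
    induction k with
    | zero => exact Nat.find_spec hex
    | succ k ih =>
      simp only [t, Function.iterate_succ_apply']
      exact h2 _ ih
  have hsucc : ∀ k, t (k + 1) = next (t k) := fun k => Function.iterate_succ_apply' _ _ _
  refine ⟨t, strictMono_nat_of_lt_succ fun k => ?_, fun i hi => ?_, fun k => ?_⟩
  · rw [hsucc]
    exact h1 _ (ht k)
  · exact not_not.1 (Nat.find_min hex hi)
  · rw [hsucc]
    exact h3 _ (ht k)

/-- After the exceptional case the orbit is at `0`, of minimal height. A further block would again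
preserve the height, hence start at `1` and not at `0`; so it does not end before `N`. -/
theorem height_decrease {s : ℕ → Fin (c.lastDigit + 1)} {t : ℕ → ℕ} (ht : StrictMono t)
    (hb : ∀ k, IsDecreasingBlock c.σ c.σ' c.A (subword s (t k) (t (k + 1) - t k + 1)))
    {α : OnePoint c.K} {N : ℕ}
    (h : ∀ k < N, OnePoint.map c.σ (c.T^[k] α) ∈ interval c.σ (c.A (s k))) {k : ℕ}
    (hk : t (k + 1) < N) :
    height (c.T^[t (k + 1)] α) ≤ height (c.T^[t k] α) ∧
      (height (c.T^[t (k + 1)] α) = height (c.T^[t k] α) ↔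
        c.T^[t k] α = ((1 : c.K) : OnePoint c.K)) ∧
      (c.T^[t k] α = ((1 : c.K) : OnePoint c.K) →
        c.T^[t (k + 1)] α = ((0 : c.K) : OnePoint c.K) ∧ N ≤ t (k + 2)) := by
  obtain ⟨h1, h2, h3⟩ := height_le_of_block h (ht (Nat.lt_succ_self k)) hk (hb k)
  refine ⟨h1, h2, fun h' => ⟨h3 h', ?_⟩⟩
  by_contra! hlt
  obtain ⟨g1, g2, -⟩ := height_le_of_block h (ht (Nat.lt_succ_self (k + 1))) hlt (hb (k + 1))
  rw [h3 h', height_zero] at g1 g2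
  have := g2.1 (le_antisymm g1 (one_le_height _))
  rw [OnePoint.coe_eq_coe] at this
  exact zero_ne_one this

theorem map_iterate_mem {α : OnePoint c.K} (hα : OnePoint.map c.σ α ∈ baseInterval) (k : ℕ) :
    OnePoint.map c.σ (c.T^[k] α) ∈ baseInterval := by
  induction k with
  | zero => exact hα
  | succ k ih =>
    obtain ⟨i, hi⟩ := c.exists_mem_interval ih
    rw [Function.iterate_succ_apply', c.T_eq hi]
    exact mem_interval_iff.1 hi

theorem isParabolic_of_represents {P : GL (Fin 2) c.K} {M : Mat (ZW c.ca c.cb)}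
    (h : c.Represents P M) (ha : M.a = 1) (hd : M.d = 1)
    (hbc : (M.b = 0 ∧ 0 < M.c.val) ∨ (0 < M.b.val ∧ M.c = 0)) : P.IsParabolic := by
  have hpos : ∀ z : ZW c.ca c.cb, 0 < z.val → c.phi z ≠ 0 := by
    intro z hz h0
    rw [← embed_phi, h0, map_zero] at hz
    exact lt_irrefl _ hz
  have hM : (M.map c.phi).toMatrix.IsParabolic := by
    constructor
    · rintro ⟨r, hr⟩
      have h1 := congrFun (congrFun hr 0) 1
      have h2 := congrFun (congrFun hr 1) 0
      simp [Mat.toMatrix, Mat.map] at h1 h2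
      rcases hbc with ⟨-, hc⟩ | ⟨hb, -⟩
      · exact hpos _ hc h2.symm
      · exact hpos _ hb h1.symm
    · rw [discr_fin_two, trace_fin_two, det_fin_two]
      rcases hbc with ⟨hb, -⟩ | ⟨-, hc⟩
      · simp [Mat.toMatrix, Mat.map, ha, hd, hb]
        norm_num
      · simp [Mat.toMatrix, Mat.map, ha, hd, hc]
        norm_num
  rcases h with h | h
  · rwa [GeneralLinearGroup.IsParabolic, h]
  · rw [GeneralLinearGroup.IsParabolic, h]
    exact hM.neg

theorem isParabolicFixedPoint_of_smul_eq {i : Fin (c.lastDigit + 1)} {x : OnePoint c.K}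
    (hx : OnePoint.map c.σ x ∈ interval c.σ (c.A i)) (hp : (c.A i).IsParabolic)
    (hfix : c.A i • x = x) : IsParabolicFixedPoint c.σ c.A x := by
  refine ⟨?_, i, hp, hfix⟩
  change c.T x = x
  rw [c.T_eq hx]
  exact inv_smul_eq_of_eq hfix.symm

/-- Undoing one step in the last interval adds `b q` to `p`, so a run of length `j` gives `x ≥ j b`.
Homogeneous coordinates include the point `∞`. -/
theorem exists_pair_of_run_last (j : ℕ) : ∀ x : OnePoint c.K,
    (∀ k, OnePoint.map c.σ (c.T^[k] x) ∈ baseInterval) →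
    (∀ k < j, OnePoint.map c.σ (c.T^[k] x) ∈ interval c.σ (c.A (Fin.last c.lastDigit))) →
    ∃ p q : c.K, (p ≠ 0 ∨ q ≠ 0) ∧ x = ofPair p q ∧ 0 ≤ c.σ p ∧ 0 ≤ c.σ q ∧
      j * (c.nmats c.lastDigit).b.val * c.σ q ≤ c.σ p := by
  induction j with
  | zero =>
    intro x hx _
    obtain ⟨p, q, h1, h2, h3, h4⟩ := c.exists_nonneg_pair (hx 0)
    exact ⟨p, q, h1, h2, h3, h4, by simpa using h3⟩
  | succ j ih =>
    intro x hx h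
    obtain ⟨p, q, h1, h2, h3, h4, h5⟩ := ih (c.T x) (fun k => hx (k + 1))
      (fun k hk => h (k + 1) (by omega))
    have hT := c.T_eq (h 0 (by omega))
    simp only [Function.iterate_zero, id_eq] at hT
    rw [hT, inv_smul_eq_iff, c.smul_ofPair _ h1] at h2
    obtain ⟨e1, e2, e3, e4⟩ := c.nmats_last
    simp only [Fin.val_last, e1, e3, e4, map_one, map_zero, one_mul, zero_mul, zero_add] at h2
    refine ⟨_, _, ?_, h2, ?_, h4, ?_⟩
    · rcases eq_or_ne q 0 with rfl | hq
      · left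
        simpa using h1
      · exact Or.inr hq
    · rw [map_add, map_mul, embed_phi]
      positivity
    · rw [map_add, map_mul, embed_phi]
      push_cast
      linarith

theorem exists_pair_of_run_zero (hc : (c.nmats 0).det = 1) (j : ℕ) : ∀ x : OnePoint c.K,
    (∀ k, OnePoint.map c.σ (c.T^[k] x) ∈ baseInterval) →
    (∀ k < j, OnePoint.map c.σ (c.T^[k] x) ∈ interval c.σ (c.A 0)) →
    ∃ p q : c.K, (p ≠ 0 ∨ q ≠ 0) ∧ x = ofPair p q ∧ 0 ≤ c.σ p ∧ 0 ≤ c.σ q ∧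
      j * (c.nmats 0).c.val * c.σ p ≤ c.σ q := by
  induction j with
  | zero =>
    intro x hx _
    obtain ⟨p, q, h1, h2, h3, h4⟩ := c.exists_nonneg_pair (hx 0)
    exact ⟨p, q, h1, h2, h3, h4, by simpa using h4⟩
  | succ j ih =>
    intro x hx h
    obtain ⟨p, q, h1, h2, h3, h4, h5⟩ := ih (c.T x) (fun k => hx (k + 1))
      (fun k hk => h (k + 1) (by omega))
    have hT := c.T_eq (h 0 (by omega))
    simp only [Function.iterate_zero, id_eq] at hT
    rw [hT, inv_smul_eq_iff, c.smul_ofPair _ h1] at h2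
    obtain ⟨e1, e2, e3, e4⟩ := c.nmats_zero.resolve_right
      fun h => one_ne_neg_one (hc.symm.trans h.2)
    simp only [Fin.val_zero, e1, e2, e4, map_one, map_zero, one_mul, zero_mul, add_zero] at h2
    refine ⟨_, _, ?_, h2, h3, ?_, ?_⟩
    · rcases eq_or_ne p 0 with rfl | hp
      · right
        simpa using h1
      · exact Or.inl hp
    · rw [map_add, map_mul, embed_phi]
      positivity
    · rw [map_add, map_mul, embed_phi]
      push_cast
      linarith

theorem sigma_ne_zero {p : c.K} (h : 0 ≤ c.σ p) (hp : p ≠ 0) : 0 < c.σ p :=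
  lt_of_le_of_ne h fun h' => hp ((map_eq_zero c.σ).1 h'.symm)

theorem eq_infty_of_run {x : OnePoint c.K}
    (hx : ∀ k, OnePoint.map c.σ (c.T^[k] x) ∈ baseInterval)
    (h : ∀ k, OnePoint.map c.σ (c.T^[k] x) ∈ interval c.σ (c.A (Fin.last c.lastDigit))) :
    x = ∞ := by
  obtain ⟨-, hb, -, -⟩ := c.nmats_last
  by_contra hne
  obtain ⟨k, rfl⟩ := OnePoint.ne_infty_iff_exists.1 hne
  obtain ⟨j, hj⟩ := exists_nat_gt (c.σ k / (c.nmats c.lastDigit).b.val)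
  rw [div_lt_iff₀ hb] at hj
  obtain ⟨p, q, h1, h2, h3, h4, h5⟩ := exists_pair_of_run_last j _ hx fun k _ => h k
  rw [← ofPair_one, ofPair_eq_iff (Or.inr one_ne_zero) h1, mul_one] at h2
  have hq : q ≠ 0 := by
    rintro rfl
    rw [mul_zero] at h2
    exact h1.elim (fun h => h h2.symm) fun h => h rfl
  have hpos := sigma_ne_zero h4 hq
  rw [← h2, map_mul] at h5
  exact absurd (le_of_mul_le_mul_right h5 hpos) hj.not_ge

theorem eq_zero_of_run (hc : (c.nmats 0).det = 1) {x : OnePoint c.K}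
    (hx : ∀ k, OnePoint.map c.σ (c.T^[k] x) ∈ baseInterval)
    (h : ∀ k, OnePoint.map c.σ (c.T^[k] x) ∈ interval c.σ (c.A 0)) :
    x = ((0 : c.K) : OnePoint c.K) := by
  obtain ⟨-, -, hb, -⟩ := c.nmats_zero.resolve_right
    fun h => one_ne_neg_one (hc.symm.trans h.2)
  induction x with
  | infty =>
    exfalso
    -- One step already excludes `∞`, where `q = 0`.
    obtain ⟨p, q, h1, h2, h3, h4, h5⟩ := exists_pair_of_run_zero hc 1 _ hx fun k _ => h k
    rw [← ofPair_one_zero, ofPair_eq_iff (Or.inl one_ne_zero) h1, one_mul, mul_zero] at h2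
    subst h2
    have hpos := sigma_ne_zero h3 (h1.resolve_right fun h => h rfl)
    rw [map_zero, Nat.cast_one, one_mul] at h5
    exact absurd (mul_pos hb hpos) h5.not_gt
  | coe k =>
    rw [OnePoint.coe_eq_coe]
    by_contra hk
    have hk0 := hx 0
    rw [Function.iterate_zero, id_eq, OnePoint.map_some, coe_mem_baseInterval] at hk0
    have hkpos := sigma_ne_zero hk0 hk
    obtain ⟨j, hj⟩ := exists_nat_gt (1 / ((c.nmats 0).c.val * c.σ k))
    rw [div_lt_iff₀ (mul_pos hb hkpos), ← mul_assoc] at hj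
    obtain ⟨p, q, h1, h2, h3, h4, h5⟩ := exists_pair_of_run_zero hc j _ hx fun k _ => h k
    rw [← ofPair_one, ofPair_eq_iff (Or.inr one_ne_zero) h1, mul_one] at h2
    have hq : q ≠ 0 := by
      rintro rfl
      rw [mul_zero] at h2
      exact h1.elim (fun h => h h2.symm) fun h => h rfl
    have hpos := sigma_ne_zero h4 hq
    rw [← h2, map_mul, ← mul_assoc] at h5
    exact absurd (le_of_mul_le_mul_right (h5.trans_eq (one_mul _).symm) hpos) hj.not_ge

/-- Any itinerary of the orbit will do. A parabolic tail leaves the orbit at `∞` or `0`; without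
one, the block ends would be infinitely many points of bounded height. -/
theorem exists_parabolicFixedPoint {α : OnePoint c.K}
    (hα : OnePoint.map c.σ α ∈ baseInterval) :
    ∃ n, IsParabolicFixedPoint c.σ c.A (c.T^[n] α) := by
  have hbase := map_iterate_mem hα
  choose s hs using fun k => c.exists_mem_interval (hbase k)
  have hshift : ∀ (b : Fin (c.lastDigit + 1)), EndsWith s b → ∃ n,
      (∀ k, OnePoint.map c.σ (c.T^[k] (c.T^[n] α)) ∈ baseInterval) ∧
      (∀ k, OnePoint.map c.σ (c.T^[k] (c.T^[n] α)) ∈ interval c.σ (c.A b)) := by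
    intro b hb
    obtain ⟨n, hn⟩ := eventually_atTop.1 hb
    refine ⟨n, fun k => ?_, fun k => ?_⟩
    · rw [← Function.iterate_add_apply]
      exact hbase _
    · rw [← Function.iterate_add_apply, ← hn (k + n) (by omega)]
      exact hs _
  by_cases hl : EndsWith s (Fin.last c.lastDigit)
  · obtain ⟨n, hn1, hn2⟩ := hshift _ hl
    obtain ⟨e1, e2, e3, e4⟩ := c.nmats_last
    refine ⟨n, isParabolicFixedPoint_of_smul_eq (hn2 0)
      (isParabolic_of_represents (represents_A _) e1 e4 (Or.inr ⟨e2, e3⟩)) ?_⟩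
    rw [eq_infty_of_run hn1 hn2, ← ofPair_one_zero, c.smul_ofPair _ (Or.inl one_ne_zero)]
    simp [e1, e3]
  by_cases hz : (c.A 0).val.det = 1 ∧ EndsWith s 0
  · obtain ⟨n, hn1, hn2⟩ := hshift _ hz.2
    have hd : (c.nmats 0).det = 1 := by
      rcases c.det_A_zero with h | h
      · exact h.2
      · have := h.1.symm.trans hz.1
        norm_num at this
    obtain ⟨e1, e2, e3, e4⟩ := c.nmats_zero.resolve_right
      fun h => one_ne_neg_one (hd.symm.trans h.2)
    refine ⟨n, isParabolicFixedPoint_of_smul_eq (hn2 0)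
      (isParabolic_of_represents (represents_A _) e1 e4 (Or.inl ⟨e2, e3⟩)) ?_⟩
    rw [eq_zero_of_run hd hn1 hn2, ← ofPair_one, c.smul_ofPair _ (Or.inr one_ne_zero)]
    simp [e2, e4]
  · exfalso
    push Not at hz
    obtain ⟨t, ht, -, hb⟩ := exists_splitting hl hz
    have hlt : ∀ k, height (c.T^[t (k + 1)] α) < height (c.T^[t k] α) := by
      intro k
      -- With `N = t (k + 2) + 1` the exceptional case, which requires `N ≤ t (k + 2)`, cannot
      -- occur.
      obtain ⟨h1, h2, h3⟩ := height_decrease ht hb (α := α) (N := t (k + 2) + 1) (k := k)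
        (fun i _ => hs i) ((ht (Nat.lt_succ_self (k + 1))).trans (Nat.lt_succ_self _))
      refine lt_of_le_of_ne h1 fun he => ?_
      have := (h3 (h2.1 he)).2
      omega
    have hanti : StrictAnti fun k => height (c.T^[t k] α) := strictAnti_nat_of_succ_lt hlt
    obtain ⟨m, -, n, -, hmn, h⟩ := Set.infinite_univ.exists_ne_map_eq_of_mapsTo
      (f := fun k => c.T^[t k] α) (fun k _ => hanti.antitone (Nat.zero_le k))
      (finite_height_le (c.T^[t 0] α))
    exact hmn (hanti.injective (congrArg height h))

end Case

end QuadGauss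

theorem theorem5p3 (c : QuadGauss.Case) :
    -- the matrices have entries in the ring of integers
    (∀ a i j, IsIntegral ℤ (c.A a i j)) ∧
    -- there is a complete set of decreasing blocks
    (∃ B : Set (List (Fin (c.lastDigit + 1))),
      QuadGauss.IsCompleteSet c.σ c.σ' c.A B ∧
      -- every infinite word without parabolic tail splits in an initial run of the last digit and
      -- a sequence of blocks in `B`, consecutive blocks sharing one digit
      ∀ s : ℕ → Fin (c.lastDigit + 1),
        ¬ QuadGauss.EndsWith s (Fin.last c.lastDigit) →
        ((c.A 0).val.det = 1 → ¬ QuadGauss.EndsWith s 0) →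
        ∃ t : ℕ → ℕ, StrictMono t ∧
          (∀ i < t 0, s i = Fin.last c.lastDigit) ∧
          (∀ k, QuadGauss.subword s (t k) (t (k + 1) - t k + 1) ∈ B) ∧
          -- along a field point whose symbolic orbit starts with the first `N` digits of `s`,
          -- the height decreases at the ends of the blocks
          ∀ (α : OnePoint c.K) (N : ℕ),
            (∀ k < N, OnePoint.map c.σ (c.T^[k] α) ∈ QuadGauss.interval c.σ (c.A (s k))) →
            ∀ k, t (k + 1) < N →
              QuadGauss.height (c.T^[t (k + 1)] α) ≤ QuadGauss.height (c.T^[t k] α) ∧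
              (QuadGauss.height (c.T^[t (k + 1)] α) = QuadGauss.height (c.T^[t k] α) ↔
                c.T^[t k] α = ((1 : c.K) : OnePoint c.K)) ∧
              (c.T^[t k] α = ((1 : c.K) : OnePoint c.K) →
                c.T^[t (k + 1)] α = ((0 : c.K) : OnePoint c.K) ∧ N ≤ t (k + 2))) ∧
    -- the orbit of every field point in `[0, ∞]` reaches a parabolic fixed point
    (∀ α : OnePoint c.K, OnePoint.map c.σ α ∈ QuadGauss.baseInterval →
      ∃ n : ℕ, QuadGauss.IsParabolicFixedPoint c.σ c.A (c.T^[n] α)) := by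
  refine ⟨QuadGauss.Case.isIntegral_A, ⟨_, c.isCompleteSet, fun s hl hz => ?_⟩,
    fun α hα => QuadGauss.Case.exists_parabolicFixedPoint hα⟩
  obtain ⟨t, ht, h0, hb⟩ := QuadGauss.Case.exists_splitting hl hz
  exact ⟨t, ht, h0, hb, fun α N h k hk => QuadGauss.Case.height_decrease ht hb h hk⟩
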